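/- Let $\theta\in(0,\pi/2)$, let $$\mathsf{Gui}(\theta)=\Big\{(r,z)\in(0,\infty)\times\mathbb R:\ -\tfrac{\pi}{\sin\theta}<z,\ \max(0,z\tan\theta)<r<z\tan\theta+\tfrac{\pi}{\cos\theta}\Big\},$$ let $\mathsf{Lay}(\theta)=\mathsf{Gui}(\theta)\times\mathbb S^1$ with $\mathbb S^1=\mathbb R/2\pi\mathbb Z$ (cylindrical coordinates $(r,z,\phi)$), and let $L^2_{\mathsf{cyl}}(\mathsf{Lay}(\theta))=L^2(\mathsf{Lay}(\theta);r\,dr\,dz\,d\phi)$ be the space of complex-valued square-integrable functions. For a real-valued $\omega\in L^2(\mathbb S^1)$ let $\mathbf A_\omega=\frac{\omega(\phi)}{r}\mathbf e_\phi$, and let $$Q_{\omega,\theta,0}[u]=\|(i\nabla-\mathbf A_\omega)u\|^2=\int_{\mathsf{Lay}(\theta)}\Big(|\partial_ru|^2+|\partial_zu|^2+\frac{|i\partial_\phi u-\omega u|^2}{r^2}\Big)r\,dr\,dz\,d\phi,\qquad u\in C_0^\infty(\mathsf{Lay}(\theta)).$$ This form is closable in $L^2_{\mathsf{cyl}}(\mathsf{Lay}(\theta))$.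 Let $Q_{\omega,\theta}$ be its closure, and let $\mathsf H_{\omega,\theta}$ be the operator associated with $Q_{\omega,\theta}$: $u\in\mathrm{dom}\,\mathsf H_{\omega,\theta}$ and $\mathsf H_{\omega,\theta}u=f$ if and only if $u\in\mathrm{dom}\,Q_{\omega,\theta}$, $f\in L^2_{\mathsf{cyl}}(\mathsf{Lay}(\theta))$ and $Q_{\omega,\theta}(u,v)=\langle f,v\rangle$ for all $v\in\mathrm{dom}\,Q_{\omega,\theta}$ (this determines $f$ uniquely and defines a linear operator). Let $\omega\in L^2(\mathbb S^1)$ be real-valued and $k\in\mathbb Z$, and put $$\Phi_\omega=\frac1{2\pi}\int_0^{2\pi}\omega(\phi)\,d\phi,\qquad V(\phi)=(\Phi_\omega+k)\phi-\int_0^\phi\omega(\xi)\,d\xi\quad(0\le\phi<2\pi),\qquad \mathsf G_Vu=e^{iV}u,$$ so that $\mathsf G_V$ is a unitary operator in $L^2_{\mathsf{cyl}}(\mathsf{Lay}(\theta))$. Regard the number $\Phi_\omega+k$ as a constant function on $\mathbb S^1$. Then: (i) $\mathrm{dom}\,Q_{\omega,\theta}=\mathsf G_V\big(\mathrm{dom}\,Q_{\Phi_\omega+k,\theta}\big)$;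 (ii) $Q_{\omega,\theta}[\mathsf G_Vu]=Q_{\Phi_\omega+k,\theta}[u]$ for all $u\in\mathrm{dom}\,Q_{\Phi_\omega+k,\theta}$. In particular, $\mathsf H_{\omega,\theta}$ and $\mathsf H_{\Phi_\omega+k,\theta}$ are unitarily equivalent, namely $\mathsf H_{\omega,\theta}=\mathsf G_V\,\mathsf H_{\Phi_\omega+k,\theta}\,\mathsf G_V^{-1}$, domains included. Consequently there is a constant $c\in[0,1/2]$, of the form $c=|\Phi_\omega+m|$ with $m\in\mathbb Z$, such that $\mathsf H_{\omega,\theta}$ is unitarily equivalent to $\mathsf H_{c,\theta}$. -/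

import Mathlib

open MeasureTheory Filter Topology Set

noncomputable section

namespace ConicalLayer

instance fact_two_pi_pos : Fact (0 < 2 * Real.pi) := ⟨Real.two_pi_pos⟩

/-- The circle `S¹ = ℝ / 2πℤ`. Its `volume` is the measure `dφ` of total mass `2π`. -/
abbrev S1 : Type := AddCircle (2 * Real.pi)

/-- Cylindrical coordinates `(r, z, φ)`. -/
abbrev Cyl : Type := ℝ × ℝ × S1

/-- The meridian domain. -/
def Gui (θ : ℝ) : Set (ℝ × ℝ) :=
  {p | 0 < p.1 ∧ -(Real.pi / Real.sin θ) < p.2 ∧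
    max 0 (p.2 * Real.tan θ) < p.1 ∧ p.1 < p.2 * Real.tan θ + Real.pi / Real.cos θ}

/-- The conical layer `Gui(θ) × S¹` in cylindrical coordinates. -/
def Lay (θ : ℝ) : Set Cyl := {p | (p.1, p.2.1) ∈ Gui θ}

/-- The measure `r dr dz dφ` on the conical layer. -/
def cylMeasure (θ : ℝ) : Measure Cyl :=
  ((volume : Measure Cyl).withDensity fun p => ENNReal.ofReal p.1).restrict (Lay θ)

/-- The Hilbert space `L²_cyl(Lay(θ))`. -/
abbrev L2 (θ : ℝ) : Type := Lp ℂ 2 (cylMeasure θ)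

/-- `u ∈ C₀^∞(Lay(θ))`: smooth (in the coordinates `r, z, φ`) with compact support in `Lay(θ)`. -/
def IsTest (θ : ℝ) (u : Cyl → ℂ) : Prop :=
  ContDiff ℝ ((⊤ : ℕ∞) : WithTop ℕ∞) (fun p : ℝ × ℝ × ℝ => u (p.1, p.2.1, (p.2.2 : S1))) ∧
    HasCompactSupport u ∧ tsupport u ⊆ Lay θ

/-- `∂_r u`. -/
def dr (u : Cyl → ℂ) (p : Cyl) : ℂ := deriv (fun r : ℝ => u (r, p.2.1, p.2.2)) p.1

/-- `∂_z u`. -/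
def dz (u : Cyl → ℂ) (p : Cyl) : ℂ := deriv (fun z : ℝ => u (p.1, z, p.2.2)) p.2.1

/-- `∂_φ u`. -/
def dphi (u : Cyl → ℂ) (p : Cyl) : ℂ :=
  deriv (fun s : ℝ => u (p.1, p.2.1, p.2.2 + (s : S1))) 0

/-- The vector field `(i∇ - A_ω)u` with `A_ω = (ω(φ)/r) e_φ`, in its components along the
orthonormal moving frame `(e_r, e_φ, e_z)`. -/
def magGrad (ω : S1 → ℝ) (u : Cyl → ℂ) (p : Cyl) : EuclideanSpace ℂ (Fin 3) :=
  !₂[Complex.I * dr u p,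
     Complex.I * (dphi u p / (p.1 : ℂ)) - ((ω p.2.2 / p.1 : ℝ) : ℂ) * u p,
     Complex.I * dz u p]

/-- The sesquilinear form of `Q_{ω,θ,0}` (conjugate-linear in the first argument). -/
def sesq0 (ω : S1 → ℝ) (θ : ℝ) (u v : Cyl → ℂ) : ℂ :=
  ∫ p, inner ℂ (magGrad ω u p) (magGrad ω v p) ∂(cylMeasure θ)

/-- The quadratic form `Q_{ω,θ,0}[u] = ‖(i∇ - A_ω)u‖²`. -/
def form0 (ω : S1 → ℝ) (θ : ℝ) (u : Cyl → ℂ) : ℝ :=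
  ∫ p, ‖magGrad ω u p‖ ^ 2 ∂(cylMeasure θ)

/-- Form convergence of a sequence of test functions `w n` to `u ∈ L²_cyl`: `w n → u` in `L²_cyl`
and `Q_{ω,θ,0}[w n - w m] → 0` as `n, m → ∞`. -/
def FormConv (ω : S1 → ℝ) (θ : ℝ) (w : ℕ → Cyl → ℂ) (u : L2 θ) : Prop :=
  (∀ n, IsTest θ (w n)) ∧
    Tendsto (fun n => eLpNorm (fun p => w n p - u p) 2 (cylMeasure θ)) atTop (𝓝 0) ∧
    ∀ ε > 0, ∃ N : ℕ, ∀ n ≥ N, ∀ m ≥ N, form0 ω θ (fun p => w n p - w m p) < ε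

/-- Closability of the form `Q_{ω,θ,0}`. -/
def FormClosable (ω : S1 → ℝ) (θ : ℝ) : Prop :=
  ∀ w : ℕ → Cyl → ℂ, FormConv ω θ w 0 → Tendsto (fun n => form0 ω θ (w n)) atTop (𝓝 0)

/-- The domain of the closure `Q_{ω,θ}`. -/
def domQ (ω : S1 → ℝ) (θ : ℝ) : Set (L2 θ) := {u | ∃ w, FormConv ω θ w u}

/-- The sesquilinear form of the closure `Q_{ω,θ}`: for `u, v ∈ dom Q_{ω,θ}`, the common limit of
`Q_{ω,θ,0}(w n, w' n)` along all sequences `w`, `w'` form-converging to `u` and `v`.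
(That limit exists because the form is closable; it is unique because such sequences exist.) -/
def sesqQ (ω : S1 → ℝ) (θ : ℝ) (u v : L2 θ) : ℂ :=
  Classical.epsilon fun c : ℂ => ∀ w w' : ℕ → Cyl → ℂ, FormConv ω θ w u → FormConv ω θ w' v →
    Tendsto (fun n => sesq0 ω θ (w n) (w' n)) atTop (𝓝 c)

/-- The quadratic form `Q_{ω,θ}[u]` (meaningful for `u ∈ domQ ω θ`). -/
def formQ (ω : S1 → ℝ) (θ : ℝ) (u : L2 θ) : ℝ := (sesqQ ω θ u u).re

/-- The graph of the operator associated with the closed form `Q_{ω,θ}`: the pairs `(u, f)` with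
`u ∈ dom Q_{ω,θ}` and `Q_{ω,θ}(u, v) = ⟨f, v⟩` for all `v ∈ dom Q_{ω,θ}`. -/
def assocGraph (ω : S1 → ℝ) (θ : ℝ) : Set (L2 θ × L2 θ) :=
  {x | x.1 ∈ domQ ω θ ∧ ∀ v ∈ domQ ω θ, sesqQ ω θ x.1 v = inner ℂ x.2 v}

/-- The Aharonov-Bohm magnetic Dirichlet Laplacian `H_{ω,θ}`, the operator associated with
`Q_{ω,θ}`, as an unbounded operator in `L²_cyl(Lay(θ))`. The set `assocGraph ω θ` is already a
linear subspace, so that the linear span only serves to bundle it. -/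
def opH (ω : S1 → ℝ) (θ : ℝ) : L2 θ →ₗ.[ℂ] L2 θ :=
  (Submodule.span ℂ (assocGraph ω θ)).toLinearPMap

/-- The unitary map `U` transforms the unbounded operator `A` into `B`, i.e. `B = U A U⁻¹`,
domains included. -/
def Intertwines {θ : ℝ} (U : L2 θ ≃ₗᵢ[ℂ] L2 θ) (A B : L2 θ →ₗ.[ℂ] L2 θ) : Prop :=
  (B.domain : Set (L2 θ)) = U '' (A.domain : Set (L2 θ)) ∧
    ∀ (x : A.domain) (y : B.domain), (y : L2 θ) = U x → B y = U (A x)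

/-- Unitary equivalence of unbounded operators. -/
def UnitarilyEquivalent {θ : ℝ} (A B : L2 θ →ₗ.[ℂ] L2 θ) : Prop :=
  ∃ U : L2 θ ≃ₗᵢ[ℂ] L2 θ, Intertwines U A B

/-- The magnetic flux `Φ_ω`. -/
def flux (ω : S1 → ℝ) : ℝ := (2 * Real.pi)⁻¹ * ∫ ξ in (0 : ℝ)..(2 * Real.pi), ω (ξ : S1)

/-- `V(φ) = (Φ_ω + k) φ - ∫_0^φ ω`. -/
def gaugeV (ω : S1 → ℝ) (k : ℤ) (φ : ℝ) : ℝ :=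
  (flux ω + k) * φ - ∫ ξ in (0 : ℝ)..φ, ω (ξ : S1)

/-- The constant `Φ_ω + k` as a function on the circle. -/
def constFlux (ω : S1 → ℝ) (k : ℤ) : S1 → ℝ := fun _ => flux ω + k

/-- The function `e^{iV}` on `S¹`, the angle being taken in `[0, 2π)`. -/
def gaugeFactor (ω : S1 → ℝ) (k : ℤ) (x : S1) : ℂ :=
  Complex.exp (Complex.I * (gaugeV ω k (AddCircle.equivIco (2 * Real.pi) 0 x : ℝ) : ℂ))

theorem norm_gaugeFactor (ω : S1 → ℝ) (k : ℤ) (x : S1) : ‖gaugeFactor ω k x‖ = 1 := by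
  rw [gaugeFactor, mul_comm]
  exact Complex.norm_exp_ofReal_mul_I _

theorem measurable_gaugeFactor {ω : S1 → ℝ} (hω : MemLp ω 2 volume) (k : ℤ) :
    Measurable (gaugeFactor ω k) := by
  have h1 : Integrable ω volume := hω.integrable (by norm_num)
  have hp : Function.Periodic (fun ξ : ℝ => ω (ξ : S1)) (2 * Real.pi) := fun ξ => by simp
  have h2 : IntervalIntegrable (fun ξ : ℝ => ω (ξ : S1)) volume 0 (0 + 2 * Real.pi) := by
    rw [intervalIntegrable_iff_integrableOn_Ioc_of_le (by linarith [Real.two_pi_pos])]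
    exact (AddCircle.measurePreserving_mk (2 * Real.pi) 0).integrable_comp_of_integrable h1
  have hc : Continuous (gaugeV ω k) := by
    unfold gaugeV
    exact (continuous_const.mul continuous_id).sub (intervalIntegral.continuous_primitive
      (fun a b => hp.intervalIntegrable Real.two_pi_pos.ne' h2 a b) 0)
  have hm : Measurable fun x : S1 => (AddCircle.equivIco (2 * Real.pi) 0 x : ℝ) :=
    measurable_subtype_coe.comp (AddCircle.measurableEquivIco (2 * Real.pi) 0).measurable
  have := hc.measurable.comp hm
  unfold gaugeFactor
  fun_prop

/-- Multiplication by a measurable function of modulus one, on `L²_cyl(Lay(θ))`. -/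
def mulFun {θ : ℝ} (g : Cyl → ℂ) (hg : Measurable g) (hn : ∀ p, ‖g p‖ = 1) (u : L2 θ) : L2 θ :=
  MemLp.toLp (fun p => g p * u p)
    ((Lp.memLp u).of_le (hg.aestronglyMeasurable.mul (Lp.aestronglyMeasurable u))
      (ae_of_all _ fun p => by simp [hn]))

theorem coeFn_mulFun {θ : ℝ} (g : Cyl → ℂ) (hg : Measurable g) (hn : ∀ p, ‖g p‖ = 1) (u : L2 θ) :
    mulFun g hg hn u =ᵐ[cylMeasure θ] fun p => g p * u p :=
  MemLp.coeFn_toLp _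

/-- Multiplication by a measurable function of modulus one as a unitary operator. -/
def mulUnitary (θ : ℝ) (g : Cyl → ℂ) (hg : Measurable g) (hn : ∀ p, ‖g p‖ = 1) :
    L2 θ ≃ₗᵢ[ℂ] L2 θ where
  toFun := mulFun g hg hn
  invFun := mulFun (fun p => (g p)⁻¹) hg.inv (fun p => by simp [hn])
  map_add' u v := by
    apply Lp.ext
    filter_upwards [coeFn_mulFun g hg hn (u + v), coeFn_mulFun g hg hn u, coeFn_mulFun g hg hn v,
      Lp.coeFn_add u v, Lp.coeFn_add (mulFun g hg hn u) (mulFun g hg hn v)] with p h1 h2 h3 h4 h5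
    rw [h1, h5, Pi.add_apply, h2, h3, h4, Pi.add_apply, mul_add]
  map_smul' c u := by
    apply Lp.ext
    filter_upwards [coeFn_mulFun g hg hn (c • u), coeFn_mulFun g hg hn u,
      Lp.coeFn_smul c u, Lp.coeFn_smul c (mulFun g hg hn u)] with p h1 h2 h3 h4
    simp only [RingHom.id_apply]
    rw [h1, h4, Pi.smul_apply, h2, h3, Pi.smul_apply, smul_eq_mul, smul_eq_mul]
    ring
  left_inv u := by
    apply Lp.ext
    filter_upwards [coeFn_mulFun (fun p => (g p)⁻¹) hg.inv (fun p => by simp [hn])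
      (mulFun g hg hn u), coeFn_mulFun g hg hn u] with p h1 h2
    have h0 : g p ≠ 0 := fun h => by simpa [h] using hn p
    rw [h1, h2, inv_mul_cancel_left₀ h0]
  right_inv u := by
    apply Lp.ext
    filter_upwards [coeFn_mulFun (fun p => (g p)⁻¹) hg.inv (fun p => by simp [hn]) u,
      coeFn_mulFun g hg hn (mulFun (fun p => (g p)⁻¹) hg.inv (fun p => by simp [hn]) u)]
      with p h1 h2
    have h0 : g p ≠ 0 := fun h => by simpa [h] using hn p
    rw [h2, h1, mul_inv_cancel_left₀ h0]
  norm_map' u := by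
    change ‖mulFun g hg hn u‖ = ‖u‖
    rw [Lp.norm_def, Lp.norm_def]
    congr 1
    apply eLpNorm_congr_norm_ae
    filter_upwards [coeFn_mulFun g hg hn u] with p h1
    rw [h1, norm_mul, hn, one_mul]

/-- The gauge transform `G_V u = e^{iV} u`, a unitary operator in `L²_cyl(Lay(θ))`. -/
def gaugeTransform (θ : ℝ) {ω : S1 → ℝ} (hω : MemLp ω 2 volume) (k : ℤ) : L2 θ ≃ₗᵢ[ℂ] L2 θ :=
  mulUnitary θ (fun p => gaugeFactor ω k p.2.2)
    ((measurable_gaugeFactor hω k).comp (measurable_snd.comp measurable_snd))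
    (fun p => norm_gaugeFactor ω k p.2.2)

end ConicalLayer

end

open ConicalLayer

/-!
Let `δ = Φ_ω + k - ω`, which has integral `2πk`. If `δ` is smooth, then `e^{i ∫_0^φ δ}` is a
smooth function on the circle, multiplication by it preserves the test functions, and the product
rule gives `(i∇ - A_ω) (e^{i ∫ δ} u) = e^{i ∫ δ} (i∇ - A_{ω+δ}) u`. In general, approximate `δ` in
`L²(S¹)` by smooth functions with the same integral. On a fixed test function both sides converge
in `L²`, because `u / r` is bounded with compact support, so the identity passes to the limit inside
the graph of the closure of the magnetic gradient. That closure is again the graph of an operator,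
because `i∇ - A_ω` has a formal adjoint that maps test functions into `L²_cyl`; hence the gauge
transform carries one closed form to the other. For the last claim, take `m = -round Φ_ω`; if
`Φ_ω + m < 0`, the reflection `φ ↦ -φ` reverses its sign.
-/

open scoped ComplexConjugate

noncomputable section

namespace ConicalLayer

/-- The covering map `(r, z, t) ↦ (r, z, t mod 2π)`; through it, smoothness and derivatives on
`Cyl` are those of functions on `ℝ³`. -/
def cover : ℝ × ℝ × ℝ →+ Cyl where
  toFun q := (q.1, q.2.1, (q.2.2 : S1))
  map_zero' := rfl
  map_add' _ _ := rfl

theorem cover_apply (r z t : ℝ) : cover (r, z, t) = (r, z, (t : S1)) := rfl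

theorem isOpenQuotientMap_cover : IsOpenQuotientMap cover :=
  IsOpenQuotientMap.id.prodMap (IsOpenQuotientMap.id.prodMap QuotientAddGroup.isOpenQuotientMap_mk)

theorem continuous_cover : Continuous cover := isOpenQuotientMap_cover.continuous

theorem cover_surjective : Function.Surjective cover := isOpenQuotientMap_cover.surjective

/-- Smoothness in the coordinates `r, z, φ`, in the form in which it enters `IsTest`. -/
def SmoothCyl (u : Cyl → ℂ) : Prop := ContDiff ℝ (⊤ : ℕ∞) (u ∘ cover)

/-- The derivative of `u` in the constant coordinate direction `v`. -/
def cylDeriv (v : ℝ × ℝ × ℝ) (u : Cyl → ℂ) (p : Cyl) : ℂ :=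
  deriv (fun s : ℝ => u (p + cover (s • v))) 0

theorem dr_eq_cylDeriv (u : Cyl → ℂ) : dr u = cylDeriv (1, 0, 0) u := by
  funext p
  simpa [cylDeriv, dr, cover_apply, Prod.add_def] using
    (deriv_comp_const_add (f := fun r : ℝ => u (r, p.2.1, p.2.2)) p.1 0).symm

theorem dz_eq_cylDeriv (u : Cyl → ℂ) : dz u = cylDeriv (0, 1, 0) u := by
  funext p
  simpa [cylDeriv, dz, cover_apply, Prod.add_def] using
    (deriv_comp_const_add (f := fun z : ℝ => u (p.1, z, p.2.2)) p.2.1 0).symm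

theorem dphi_eq_cylDeriv (u : Cyl → ℂ) : dphi u = cylDeriv (0, 0, 1) u := by
  funext p
  simp [cylDeriv, dphi, cover_apply, Prod.add_def]

section Calculus

variable {u w : Cyl → ℂ} {p : Cyl}

theorem SmoothCyl.continuous (hu : SmoothCyl u) : Continuous u :=
  isOpenQuotientMap_cover.continuous_comp_iff.1 (ContDiff.continuous hu)

theorem SmoothCyl.add (hu : SmoothCyl u) (hw : SmoothCyl w) : SmoothCyl fun p => u p + w p :=
  ContDiff.add hu hw

theorem SmoothCyl.mul (hu : SmoothCyl u) (hw : SmoothCyl w) : SmoothCyl fun p => u p * w p :=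
  ContDiff.mul hu hw

theorem SmoothCyl.conj (hu : SmoothCyl u) : SmoothCyl fun p => conj (u p) :=
  Complex.conjCLE.contDiff.comp hu

theorem smoothCyl_const (c : ℂ) : SmoothCyl fun _ => c := contDiff_const

theorem smoothCyl_radius : SmoothCyl fun p => (p.1 : ℂ) :=
  Complex.ofRealCLM.contDiff.comp contDiff_fst

theorem SmoothCyl.cylDeriv_cover (hu : SmoothCyl u) (v q : ℝ × ℝ × ℝ) :
    cylDeriv v u (cover q) = fderiv ℝ (u ∘ cover) q v := by
  rw [← (ContDiff.differentiable hu (by simp)).differentiableAt.lineDeriv_eq_fderiv]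
  simp only [cylDeriv, lineDeriv, Function.comp_apply, map_add]

protected theorem SmoothCyl.cylDeriv (hu : SmoothCyl u) (v : ℝ × ℝ × ℝ) :
    SmoothCyl (cylDeriv v u) := by
  have h : cylDeriv v u ∘ cover = fun q => fderiv ℝ (u ∘ cover) q v :=
    funext (hu.cylDeriv_cover v)
  rw [SmoothCyl, h]
  exact (ContDiff.fderiv_right hu (by simp)).clm_apply contDiff_const

theorem SmoothCyl.hasDerivAt (hu : SmoothCyl u) (v : ℝ × ℝ × ℝ) (p : Cyl) (s : ℝ) :
    HasDerivAt (fun s : ℝ => u (p + cover (s • v)))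
      (cylDeriv v u (p + cover (s • v))) s := by
  obtain ⟨q, rfl⟩ := cover_surjective p
  have hline : HasDerivAt (fun s : ℝ => q + s • v) v s := by
    simpa using ((hasDerivAt_id s).smul_const v).const_add q
  rw [← map_add, hu.cylDeriv_cover]
  exact ((ContDiff.differentiable hu (by simp)).differentiableAt.hasFDerivAt.comp_hasDerivAt s
    hline).congr_of_eventuallyEq (.of_forall fun s => by simp only [Function.comp_apply, map_add])

theorem SmoothCyl.hasDerivAt_zero (hu : SmoothCyl u) (v : ℝ × ℝ × ℝ) (p : Cyl) :
    HasDerivAt (fun s : ℝ => u (p + cover (s • v))) (cylDeriv v u p) 0 := by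
  simpa using hu.hasDerivAt v p 0

theorem cylDeriv_add (hu : SmoothCyl u) (hw : SmoothCyl w) (v : ℝ × ℝ × ℝ) (p : Cyl) :
    cylDeriv v (fun p => u p + w p) p = cylDeriv v u p + cylDeriv v w p :=
  ((hu.hasDerivAt_zero v p).add (hw.hasDerivAt_zero v p)).deriv

theorem cylDeriv_mul (hu : SmoothCyl u) (hw : SmoothCyl w) (v : ℝ × ℝ × ℝ) (p : Cyl) :
    cylDeriv v (fun p => u p * w p) p = cylDeriv v u p * w p + u p * cylDeriv v w p := by
  refine ((hu.hasDerivAt_zero v p).mul (hw.hasDerivAt_zero v p)).deriv.trans ?_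
  simp only [zero_smul, map_zero, add_zero]

theorem cylDeriv_conj (hu : SmoothCyl u) (v : ℝ × ℝ × ℝ) (p : Cyl) :
    cylDeriv v (fun p => conj (u p)) p = conj (cylDeriv v u p) :=
  (hu.hasDerivAt_zero v p).star.deriv

theorem cylDeriv_const_mul (c : ℂ) (hu : SmoothCyl u) (v : ℝ × ℝ × ℝ) (p : Cyl) :
    cylDeriv v (fun p => c * u p) p = c * cylDeriv v u p :=
  ((hu.hasDerivAt_zero v p).const_mul c).deriv

theorem cylDeriv_radius (v : ℝ × ℝ × ℝ) (p : Cyl) :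
    cylDeriv v (fun p => (p.1 : ℂ)) p = v.1 := by
  have h : HasDerivAt (fun s : ℝ => p.1 + s * v.1) v.1 0 := by
    simpa using ((hasDerivAt_id (0 : ℝ)).mul_const v.1).const_add p.1
  exact h.ofReal_comp.deriv

theorem cylDeriv_neg (v : ℝ × ℝ × ℝ) (u : Cyl → ℂ) (p : Cyl) :
    cylDeriv (-v) u p = -cylDeriv v u p := by
  simpa [cylDeriv] using deriv_comp_neg (fun s : ℝ => u (p + cover (s • v))) 0

theorem cylDeriv_eq_zero (v : ℝ × ℝ × ℝ) (hp : p ∉ tsupport u) : cylDeriv v u p = 0 := by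
  have hline : Tendsto (fun s : ℝ => p + cover (s • v)) (𝓝 0) (𝓝 p) :=
    Continuous.tendsto' (continuous_const.add (continuous_cover.comp (by fun_prop))) _ _ (by simp)
  have h0 : (fun s : ℝ => u (p + cover (s • v))) =ᶠ[𝓝 0] fun _ => 0 :=
    hline.eventually (notMem_tsupport_iff_eventuallyEq.1 hp)
  rw [cylDeriv, h0.deriv_eq, deriv_const]

end Calculus

section TestFunctions

variable {θ : ℝ} {u w : Cyl → ℂ} {p : Cyl}

theorem isOpen_Gui : IsOpen (Gui θ) := by
  simp only [Gui, Set.ofPred_and]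
  refine IsOpen.inter ?_ (IsOpen.inter ?_ (IsOpen.inter ?_ ?_)) <;>
    apply isOpen_lt <;> fun_prop

theorem isOpen_Lay : IsOpen (Lay θ) :=
  isOpen_Gui.preimage (f := fun p : Cyl => (p.1, p.2.1)) (by fun_prop)

theorem radius_ne_zero (hp : p ∈ Lay θ) : (p.1 : ℂ) ≠ 0 :=
  Complex.ofReal_ne_zero.2 (ne_of_gt hp.1)

theorem IsTest.smooth (hu : IsTest θ u) : SmoothCyl u := hu.1

theorem IsTest.continuous (hu : IsTest θ u) : Continuous u := hu.smooth.continuous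

theorem IsTest.hasCompactSupport (hu : IsTest θ u) : HasCompactSupport u := hu.2.1

theorem IsTest.eq_zero (hu : IsTest θ u) (hp : p ∉ Lay θ) : u p = 0 :=
  image_eq_zero_of_notMem_tsupport fun h => hp (hu.2.2 h)

theorem isTest_zero : IsTest θ 0 :=
  ⟨contDiff_const, .zero, by rw [tsupport_zero]; exact empty_subset _⟩

theorem IsTest.of_forall_notMem_tsupport (hu : IsTest θ u) (hw : SmoothCyl w)
    (h : ∀ p, p ∉ tsupport u → w p = 0) : IsTest θ w := by
  have hs : tsupport w ⊆ tsupport u :=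
    closure_minimal (fun p hp => by_contra fun hpu => hp (h p hpu)) (isClosed_tsupport u)
  exact ⟨hw, hu.2.1.of_isClosed_subset (isClosed_tsupport w) hs, hs.trans hu.2.2⟩

protected theorem IsTest.cylDeriv (hu : IsTest θ u) (v : ℝ × ℝ × ℝ) : IsTest θ (cylDeriv v u) :=
  hu.of_forall_notMem_tsupport (hu.smooth.cylDeriv v) fun _ => cylDeriv_eq_zero v

theorem IsTest.smooth_mul (hu : IsTest θ u) (hw : SmoothCyl w) : IsTest θ fun p => w p * u p :=
  hu.of_forall_notMem_tsupport (hw.mul hu.smooth) fun p hp => by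
    rw [image_eq_zero_of_notMem_tsupport hp, mul_zero]

theorem IsTest.const_mul (hu : IsTest θ u) (c : ℂ) : IsTest θ fun p => c * u p :=
  hu.smooth_mul (smoothCyl_const c)

theorem IsTest.add (hu : IsTest θ u) (hw : IsTest θ w) : IsTest θ fun p => u p + w p :=
  ⟨hu.smooth.add hw.smooth, hu.2.1.add hw.2.1,
    (tsupport_add u w).trans (union_subset hu.2.2 hw.2.2)⟩

theorem IsTest.conj (hu : IsTest θ u) : IsTest θ fun p => conj (u p) :=
  hu.of_forall_notMem_tsupport hu.smooth.conj fun p hp => by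
    rw [image_eq_zero_of_notMem_tsupport hp, map_zero]

theorem IsTest.div_radius (hu : IsTest θ u) : IsTest θ fun p => u p / p.1 := by
  refine hu.of_forall_notMem_tsupport ?_ fun p hp => by
    rw [image_eq_zero_of_notMem_tsupport hp, zero_div]
  refine contMDiff_iff_contDiff.1 (contMDiff_of_tsupport fun q hq => ContDiffAt.contMDiffAt ?_)
  have hqu : cover q ∈ tsupport u := by
    refine closure_minimal (fun x hx => ?_) ((isClosed_tsupport u).preimage continuous_cover) hq
    exact subset_tsupport u fun h0 => hx (by simp [h0])
  simp only [div_eq_mul_inv]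
  exact (ContDiff.contDiffAt hu.1).mul
    ((Complex.ofRealCLM.contDiff.comp contDiff_fst).contDiffAt.inv (radius_ne_zero (hu.2.2 hqu)))

end TestFunctions

section Measure

instance : (volume : Measure (ℝ × S1)).IsAddHaarMeasure :=
  Measure.prod.instIsAddHaarMeasure volume volume

instance : (volume : Measure Cyl).IsAddHaarMeasure :=
  Measure.prod.instIsAddHaarMeasure volume volume

variable {θ : ℝ} {u w : Cyl → ℂ}

theorem measurableSet_Lay : MeasurableSet (Lay θ) := isOpen_Lay.measurableSet

theorem cylMeasure_absolutelyContinuous : cylMeasure θ ≪ volume :=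
  Measure.restrict_le_self.absolutelyContinuous.trans (withDensity_absolutelyContinuous _ _)

instance : IsLocallyFiniteMeasure (cylMeasure θ) := by
  have : IsLocallyFiniteMeasure ((volume : Measure Cyl).withDensity fun p => .ofReal p.1) :=
    IsLocallyFiniteMeasure.withDensity_ofReal continuous_fst
  unfold cylMeasure
  infer_instance

theorem IsTest.memLp (hu : IsTest θ u) : MemLp u 2 (cylMeasure θ) :=
  hu.continuous.memLp_of_hasCompactSupport hu.hasCompactSupport

theorem integral_cylMeasure {f : Cyl → ℂ} (hf : ∀ p ∉ Lay θ, f p = 0) :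
    ∫ p, f p ∂(cylMeasure θ) = ∫ p : Cyl, (p.1 : ℂ) * f p := by
  rw [cylMeasure, restrict_withDensity measurableSet_Lay,
    integral_withDensity_eq_integral_toReal_smul (by fun_prop) (by simp),
    setIntegral_eq_integral_of_forall_compl_eq_zero (fun p hp => by rw [hf p hp, smul_zero])]
  refine integral_congr_ae (ae_of_all _ fun p => ?_)
  by_cases hp : p ∈ Lay θ
  · simp [ENNReal.toReal_ofReal hp.1.le]
  · simp [hf p hp]

theorem SmoothCyl.integral_cylDeriv_eq_zero (hu : SmoothCyl u) (hc : HasCompactSupport u)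
    (v : ℝ × ℝ × ℝ) : ∫ p : Cyl, cylDeriv v u p = 0 := by
  have hline : Continuous fun s : ℝ => cover (s • v) := continuous_cover.comp (by fun_prop)
  have hc' : HasCompactSupport (cylDeriv v u) :=
    hc.of_isClosed_subset (isClosed_tsupport _) <| closure_minimal
      (fun p hp => by_contra fun h => hp (cylDeriv_eq_zero v h)) (isClosed_tsupport u)
  obtain ⟨M, hM⟩ := hc'.exists_bound_of_continuous (hu.cylDeriv v).continuous
  let K : Set Cyl := (fun x : Cyl × ℝ => x.1 - cover (x.2 • v)) ''
    (tsupport (cylDeriv v u) ×ˢ Icc (-1) 1)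
  have hK : IsCompact K := (hc'.isCompact.prod isCompact_Icc).image
    (continuous_fst.sub (hline.comp continuous_snd))
  have hbound : ∀ s ∈ Icc (-1 : ℝ) 1, ∀ p,
      ‖cylDeriv v u (p + cover (s • v))‖ ≤ K.indicator (fun _ => M) p := by
    intro s hs p
    by_cases hp : p ∈ K
    · simpa only [indicator_of_mem hp] using hM _
    · have hp' : p + cover (s • v) ∉ tsupport (cylDeriv v u) :=
        fun h => hp ⟨(_, s), ⟨h, hs⟩, add_sub_cancel_right _ _⟩
      simp only [image_eq_zero_of_notMem_tsupport hp', norm_zero, indicator_of_notMem hp, le_refl]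
  have hderiv := (hasDerivAt_integral_of_dominated_loc_of_deriv_le
    (μ := (volume : Measure Cyl)) (F := fun s p => u (p + cover (s • v)))
    (F' := fun s p => cylDeriv v u (p + cover (s • v))) (x₀ := (0 : ℝ))
    (Icc_mem_nhds (by norm_num : (-1 : ℝ) < 0) one_pos)
    (.of_forall fun s => (hu.continuous.comp (continuous_add_const _)).aestronglyMeasurable)
    (by simpa using hu.continuous.integrable_of_hasCompactSupport hc)
    ((hu.cylDeriv v).continuous.comp (continuous_add_const _)).aestronglyMeasurable
    (ae_of_all _ fun p s hs => hbound s hs p)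
    ((integrable_indicator_iff hK.measurableSet).2 (integrableOn_const hK.measure_ne_top))
    (ae_of_all _ fun p s _ => hu.hasDerivAt v p s)).2
  -- By translation invariance the differentiated integral does not depend on `s`.
  have htrans (s : ℝ) : ∫ p, u (p + cover (s • v)) = ∫ p, u p := integral_add_right_eq_self u _
  simp only [htrans, zero_smul, map_zero, add_zero] at hderiv
  exact hderiv.unique (hasDerivAt_const _ _)

theorem IsTest.integral_conj_mul_cylDeriv_add (hw : IsTest θ w) (hu : IsTest θ u)
    (v : ℝ × ℝ × ℝ) :
    ∫ p, (conj (w p) * cylDeriv v u p + conj (cylDeriv v w p + v.1 * (w p / p.1)) * u p)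
      ∂(cylMeasure θ) = 0 := by
  have hprod : IsTest θ fun p => conj (w p) * u p := hu.smooth_mul hw.smooth.conj
  rw [integral_cylMeasure fun p hp => by simp [hw.eq_zero hp, hu.eq_zero hp],
    ← (smoothCyl_radius.mul hprod.smooth).integral_cylDeriv_eq_zero
      (hprod.smooth_mul smoothCyl_radius).hasCompactSupport v]
  refine integral_congr_ae (ae_of_all _ fun p => ?_)
  dsimp only
  rw [cylDeriv_mul smoothCyl_radius hprod.smooth, cylDeriv_mul hw.smooth.conj hu.smooth,
    cylDeriv_conj hw.smooth, cylDeriv_radius]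
  by_cases hp : p ∈ Lay θ
  · have := radius_ne_zero hp
    simp only [map_add, map_mul, map_div₀, Complex.conj_ofReal]
    field_simp
    ring
  · simp [hw.eq_zero hp, hu.eq_zero hp]

theorem exists_map_angle_restrict_le (θ : ℝ) {K : Set Cyl} (hK : IsCompact K) :
    ∃ c : NNReal, ((cylMeasure θ).restrict K).map (fun p => p.2.2) ≤ c • (volume : Measure S1) := by
  obtain ⟨R, hR⟩ := hK.isBounded.subset_closedBall (0 : Cyl)
  let B : Set ℝ := Metric.closedBall 0 R
  have hKB : K ⊆ B ×ˢ B ×ˢ univ := fun p hp => by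
    have h := hR hp
    simp only [Metric.mem_closedBall, Prod.dist_eq, max_le_iff] at h
    exact ⟨h.1, h.2.1, mem_univ _⟩
  have hle : (cylMeasure θ).restrict K ≤
      ENNReal.ofReal R • (volume.restrict B).prod ((volume.restrict B).prod volume) := by
    calc (cylMeasure θ).restrict K
        ≤ (volume.withDensity fun p : Cyl => .ofReal p.1).restrict (B ×ˢ B ×ˢ univ) :=
          Measure.restrict_mono hKB Measure.restrict_le_self
      _ ≤ (volume.restrict (B ×ˢ B ×ˢ univ)).withDensity fun _ => .ofReal R := by
          have hB : MeasurableSet (B ×ˢ B ×ˢ (univ : Set S1)) := by measurability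
          rw [restrict_withDensity hB]
          refine withDensity_mono ((ae_restrict_iff' hB).2 (ae_of_all _ fun p hp => ?_))
          exact ENNReal.ofReal_le_ofReal ((le_abs_self _).trans (mem_closedBall_zero_iff.1 hp.1))
      _ = _ := by
          rw [withDensity_const, Measure.volume_eq_prod, ← Measure.prod_restrict,
            Measure.volume_eq_prod, ← Measure.prod_restrict, Measure.restrict_univ]
  refine ⟨(ENNReal.ofReal R * (volume B * volume B)).toNNReal,
    (Measure.map_mono hle (by fun_prop)).trans_eq ?_⟩
  have hfin : ENNReal.ofReal R * (volume B * volume B) ≠ ⊤ := by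
    have hB : volume B ≠ ⊤ := measure_closedBall_lt_top.ne
    finiteness
  have hmap : ((volume.restrict B).prod ((volume.restrict B).prod (volume : Measure S1))).map
      (fun p => p.2.2) = (volume B * volume B) • volume := by
    change Measure.map (Prod.snd ∘ Prod.snd) _ = _
    rw [← Measure.map_map measurable_snd measurable_snd]
    rw [Measure.map_snd_prod, Measure.map_smul, Measure.map_snd_prod, smul_smul,
      Measure.restrict_apply_univ]
  rw [Measure.map_smul, hmap, smul_smul, ENNReal.smul_def, ENNReal.coe_toNNReal hfin]

theorem quasiMeasurePreserving_angle :
    Measure.QuasiMeasurePreserving (fun p : Cyl => p.2.2) (cylMeasure θ) volume :=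
  (Measure.quasiMeasurePreserving_snd.comp Measure.quasiMeasurePreserving_snd).mono_left
    cylMeasure_absolutelyContinuous

theorem IsTest.exists_eLpNorm_mul_le (hu : IsTest θ u) :
    ∃ C : NNReal, ∀ η : S1 → ℝ, AEStronglyMeasurable η volume →
      eLpNorm (fun p => (η p.2.2 : ℂ) * u p) 2 (cylMeasure θ) ≤ C * eLpNorm η 2 volume := by
  obtain ⟨M, hM⟩ := hu.hasCompactSupport.exists_bound_of_continuous hu.continuous
  obtain ⟨c, hc⟩ := exists_map_angle_restrict_le θ hu.hasCompactSupport.isCompact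
  refine ⟨M.toNNReal * c ^ (1 / 2 : ℝ), fun η hη => ?_⟩
  have hs : Function.support (fun p : Cyl => (η p.2.2 : ℂ) * u p) ⊆ tsupport u :=
    fun p hp => subset_tsupport u (right_ne_zero_of_mul hp)
  have hη' := hη.mono_ac
    ((Measure.absolutelyContinuous_of_le hc).trans Measure.smul_absolutelyContinuous)
  calc eLpNorm (fun p => (η p.2.2 : ℂ) * u p) 2 (cylMeasure θ)
      = eLpNorm (fun p => (η p.2.2 : ℂ) * u p) 2 ((cylMeasure θ).restrict (tsupport u)) :=
        (eLpNorm_restrict_eq_of_support_subset hs).symm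
    _ ≤ ENNReal.ofReal M *
        eLpNorm (fun p : Cyl => η p.2.2) 2 ((cylMeasure θ).restrict (tsupport u)) := by
        refine eLpNorm_le_mul_eLpNorm_of_ae_le_mul (ae_of_all _ fun p => ?_) 2
        rw [norm_mul, Complex.norm_real, mul_comm]
        exact mul_le_mul_of_nonneg_right (hM p) (norm_nonneg _)
    _ = ENNReal.ofReal M * eLpNorm η 2 (((cylMeasure θ).restrict (tsupport u)).map _) := by
        rw [eLpNorm_map_measure hη' (by fun_prop), Function.comp_def]
    _ ≤ ENNReal.ofReal M * eLpNorm η 2 (c • volume) := by gcongr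
    _ = _ := by
        rw [eLpNorm_smul_measure_of_ne_top' (by norm_num), ENNReal.coe_mul, mul_assoc]
        simp [ENNReal.smul_def, ENNReal.ofReal]

theorem IsTest.memLp_mul (hu : IsTest θ u) {η : S1 → ℝ} (hη : MemLp η 2 volume) :
    MemLp (fun p => (η p.2.2 : ℂ) * u p) 2 (cylMeasure θ) := by
  obtain ⟨C, hC⟩ := hu.exists_eLpNorm_mul_le
  have hη' : AEStronglyMeasurable (fun p : Cyl => η p.2.2) (cylMeasure θ) :=
    hη.1.comp_quasiMeasurePreserving quasiMeasurePreserving_angle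
  exact ⟨(Complex.continuous_ofReal.comp_aestronglyMeasurable hη').mul
    hu.continuous.aestronglyMeasurable,
    (hC η hη.1).trans_lt (ENNReal.mul_lt_top ENNReal.coe_lt_top hη.2)⟩

end Measure

section Density

open scoped Manifold

/-- `Cyl` as the manifold `ℝ × ℝ × Circle`. -/
def cylHomeomorph : Cyl ≃ₜ ℝ × ℝ × Circle :=
  (Homeomorph.refl ℝ).prodCongr ((Homeomorph.refl ℝ).prodCongr AddCircle.homeomorphCircle')

theorem contMDiff_cylHomeomorph_comp_cover :
    ContMDiff 𝓘(ℝ, ℝ × ℝ × ℝ) (𝓘(ℝ).prod (𝓘(ℝ).prod (𝓡 1))) (⊤ : ℕ∞) (cylHomeomorph ∘ cover) :=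
  contDiff_fst.contMDiff.prodMk ((contDiff_fst.comp contDiff_snd).contMDiff.prodMk
    (contMDiff_circleExp.comp (contDiff_snd.comp contDiff_snd).contMDiff))

theorem isTest_comp_cylHomeomorph {θ : ℝ} {g : ℝ × ℝ × Circle → ℝ}
    (hg : ContMDiff (𝓘(ℝ).prod (𝓘(ℝ).prod (𝓡 1))) 𝓘(ℝ) (⊤ : ℕ∞) g) (hc : HasCompactSupport g)
    (hsupp : tsupport g ⊆ cylHomeomorph.symm ⁻¹' Lay θ) :
    IsTest θ fun p => (g (cylHomeomorph p) : ℂ) := by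
  refine ⟨Complex.ofRealCLM.contDiff.comp
    (contMDiff_iff_contDiff.1 (hg.comp contMDiff_cylHomeomorph_comp_cover)),
    (hc.comp_homeomorph cylHomeomorph).comp_left Complex.ofReal_zero,
    (tsupport_comp_subset Complex.ofReal_zero (g ∘ cylHomeomorph)).trans ?_⟩
  rw [tsupport_comp_eq_preimage]
  exact (preimage_mono hsupp).trans fun p hp => by simpa using hp

theorem ae_eq_zero_of_forall_integral_test_mul {θ : ℝ} {f : Cyl → ℂ}
    (hf : LocallyIntegrable f (cylMeasure θ))
    (h : ∀ u, IsTest θ u → ∫ p, u p * f p ∂(cylMeasure θ) = 0) : f =ᵐ[cylMeasure θ] 0 := by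
  borelize (ℝ × ℝ × Circle)
  let e := cylHomeomorph
  have hfe : LocallyIntegrable (f ∘ e.symm) ((cylMeasure θ).map e) := by
    rw [locallyIntegrable_map_homeomorph]
    simpa [Function.comp_def] using hf
  have hopen : IsOpen (e.symm ⁻¹' Lay θ) := isOpen_Lay.preimage e.symm.continuous
  have hzero := hopen.ae_eq_zero_of_integral_contMDiff_smul_eq_zero
    (𝓘(ℝ).prod (𝓘(ℝ).prod (𝓡 1))) (hfe.locallyIntegrableOn _) fun g hg hc hsupp => by
      rw [e.measurableEmbedding.integral_map]
      simpa using h _ (isTest_comp_cylHomeomorph hg hc hsupp)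
  rw [e.measurableEmbedding.ae_map_iff] at hzero
  filter_upwards [hzero, ae_restrict_mem measurableSet_Lay] with p hp hLay
  simpa using hp (by simpa using hLay)

theorem eq_zero_of_forall_inner_test_eq_zero {θ : ℝ} {f : L2 θ}
    (h : ∀ (u : Cyl → ℂ) (hu : IsTest θ u), inner ℂ (hu.memLp.toLp u) f = 0) : f = 0 := by
  refine (Lp.eq_zero_iff_ae_eq_zero).2 (ae_eq_zero_of_forall_integral_test_mul
    ((Lp.memLp f).locallyIntegrable (by norm_num)) fun u hu => ?_)
  rw [← h _ hu.conj, L2.inner_def]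
  refine integral_congr_ae ?_
  filter_upwards [hu.conj.memLp.coeFn_toLp] with p hp
  rw [hp, RCLike.inner_apply, Complex.conj_conj, mul_comm]

end Density

section MagneticGradient

variable {θ : ℝ} {ω : S1 → ℝ} {u v g : Cyl → ℂ}

theorem magGrad_zero (ω : S1 → ℝ) (u : Cyl → ℂ) (p : Cyl) :
    magGrad ω u p 0 = Complex.I * cylDeriv (1, 0, 0) u p := by
  rw [← dr_eq_cylDeriv]; rfl

theorem magGrad_one (ω : S1 → ℝ) (u : Cyl → ℂ) (p : Cyl) :
    magGrad ω u p 1 = Complex.I * (cylDeriv (0, 0, 1) u p / p.1) - ω p.2.2 * (u p / p.1) := by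
  rw [← dphi_eq_cylDeriv, ← mul_div_assoc (ω p.2.2 : ℂ), mul_div_right_comm, ← Complex.ofReal_div]
  rfl

theorem magGrad_two (ω : S1 → ℝ) (u : Cyl → ℂ) (p : Cyl) :
    magGrad ω u p 2 = Complex.I * cylDeriv (0, 1, 0) u p := by
  rw [← dz_eq_cylDeriv]; rfl

theorem memLp_magGrad (hω : MemLp ω 2 volume) (hu : IsTest θ u) (i : Fin 3) :
    MemLp (fun p => magGrad ω u p i) 2 (cylMeasure θ) := by
  match i with
  | 0 => simpa only [magGrad_zero] using ((hu.cylDeriv _).const_mul _).memLp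
  | 1 =>
    simp only [magGrad_one]
    exact ((hu.cylDeriv _).div_radius.const_mul _).memLp.sub (hu.div_radius.memLp_mul hω)
  | 2 => simpa only [magGrad_two] using ((hu.cylDeriv _).const_mul _).memLp

theorem magGrad_add (hu : SmoothCyl u) (hv : SmoothCyl v) (p : Cyl) (i : Fin 3) :
    magGrad ω (fun p => u p + v p) p i = magGrad ω u p i + magGrad ω v p i := by
  match i with
  | 0 => simp only [magGrad_zero, cylDeriv_add hu hv]; ring
  | 1 => simp only [magGrad_one, cylDeriv_add hu hv]; ring
  | 2 => simp only [magGrad_two, cylDeriv_add hu hv]; ring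

theorem magGrad_const_mul (hu : SmoothCyl u) (c : ℂ) (p : Cyl) (i : Fin 3) :
    magGrad ω (fun p => c * u p) p i = c * magGrad ω u p i := by
  match i with
  | 0 => simp only [magGrad_zero, cylDeriv_const_mul c hu]; ring
  | 1 => simp only [magGrad_one, cylDeriv_const_mul c hu]; ring
  | 2 => simp only [magGrad_two, cylDeriv_const_mul c hu]; ring

/-- The space `C₀^∞(Lay(θ))` of test functions. -/
def testSpace (θ : ℝ) : Submodule ℂ (Cyl → ℂ) where
  carrier := {u | IsTest θ u}
  add_mem' := IsTest.add
  zero_mem' := isTest_zero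
  smul_mem' c _ hu := hu.const_mul c

/-- The square-integrable vector fields on the layer, in their components along the frame
`(e_r, e_φ, e_z)`. -/
abbrev Fld (θ : ℝ) : Type := PiLp 2 fun _ : Fin 3 => L2 θ

/-- The inclusion of the test functions in `L²_cyl`. -/
def testToL2 (θ : ℝ) : testSpace θ →ₗ[ℂ] L2 θ where
  toFun u := (IsTest.memLp u.2).toLp u
  map_add' _ _ := rfl
  map_smul' _ _ := rfl

/-- The magnetic gradient `i∇ - A_ω` on test functions, with values in the square-integrable
vector fields. -/
def magLp (θ : ℝ) (hω : MemLp ω 2 volume) : testSpace θ →ₗ[ℂ] Fld θ where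
  toFun u := WithLp.toLp 2 fun i => (memLp_magGrad hω u.2 i).toLp _
  map_add' u v := by
    ext1 i
    refine ((MemLp.toLp_eq_toLp_iff (memLp_magGrad hω (u + v).2 i) _).2
      (ae_of_all _ fun p => ?_)).trans
      (MemLp.toLp_add (memLp_magGrad hω u.2 i) (memLp_magGrad hω v.2 i))
    exact magGrad_add (IsTest.smooth u.2) (IsTest.smooth v.2) p i
  map_smul' c u := by
    ext1 i
    refine ((MemLp.toLp_eq_toLp_iff (memLp_magGrad hω (c • u).2 i) _).2
      (ae_of_all _ fun p => ?_)).trans (MemLp.toLp_const_smul c (memLp_magGrad hω u.2 i))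
    exact magGrad_const_mul (IsTest.smooth u.2) c p i

theorem magLp_apply (hω : MemLp ω 2 volume) (u : testSpace θ) (i : Fin 3) :
    magLp θ hω u i = (memLp_magGrad hω u.2 i).toLp _ := rfl

theorem integrable_conj_mul {α : Type*} [MeasurableSpace α] {μ : Measure α} {f g : α → ℂ}
    (hf : MemLp f 2 μ) (hg : MemLp g 2 μ) : Integrable (fun x => conj (f x) * g x) μ :=
  hf.star.integrable_mul hg

theorem inner_toLp {α : Type*} [MeasurableSpace α] {μ : Measure α} {f g : α → ℂ}
    (hf : MemLp f 2 μ) (hg : MemLp g 2 μ) :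
    inner ℂ (hf.toLp f) (hg.toLp g) = ∫ x, conj (f x) * g x ∂μ := by
  rw [L2.inner_def]
  refine integral_congr_ae ?_
  filter_upwards [hf.coeFn_toLp, hg.coeFn_toLp] with x hfx hgx
  rw [hfx, hgx, RCLike.inner_apply']

theorem sesq0_eq_inner (hω : MemLp ω 2 volume) (u v : testSpace θ) :
    sesq0 ω θ u v = inner ℂ (magLp θ hω u) (magLp θ hω v) := by
  simp only [sesq0, PiLp.inner_apply, RCLike.inner_apply', magLp_apply, inner_toLp]
  exact integral_finsetSum _ fun i _ =>
    integrable_conj_mul (memLp_magGrad hω u.2 i) (memLp_magGrad hω v.2 i)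

theorem form0_eq_norm_sq (hω : MemLp ω 2 volume) (u : testSpace θ) :
    form0 ω θ u = ‖magLp θ hω u‖ ^ 2 := by
  have hsesq : sesq0 ω θ u u = (form0 ω θ u : ℂ) := by
    simp only [sesq0, form0, inner_self_eq_norm_sq_to_K, ← integral_complex_ofReal]
    norm_cast
  apply Complex.ofReal_injective
  rw [← hsesq, sesq0_eq_inner hω, inner_self_eq_norm_sq_to_K]
  norm_cast

theorem IsTest.exists_magGrad_adjoint (hg : IsTest θ g) (hω : MemLp ω 2 volume) (i : Fin 3) :
    ∃ T, MemLp T 2 (cylMeasure θ) ∧ ∀ u, IsTest θ u →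
      ∫ p, (conj (g p) * magGrad ω u p i - conj (T p) * u p) ∂cylMeasure θ = 0 := by
  suffices h : ∃ T, MemLp T 2 (cylMeasure θ) ∧ ∃ w, IsTest θ w ∧ ∃ v : ℝ × ℝ × ℝ, ∀ u p,
      conj (g p) * magGrad ω u p i - conj (T p) * u p = Complex.I *
        (conj (w p) * cylDeriv v u p + conj (cylDeriv v w p + v.1 * (w p / p.1)) * u p) by
    obtain ⟨T, hT, w, hw, v, h⟩ := h
    refine ⟨T, hT, fun u hu => ?_⟩
    simp only [h, integral_const_mul, hw.integral_conj_mul_cylDeriv_add hu, mul_zero]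
  match i with
  | 0 =>
    refine ⟨fun p => Complex.I * (cylDeriv (1, 0, 0) g p + g p / p.1),
      (((hg.cylDeriv _).add hg.div_radius).const_mul _).memLp, g, hg, (1, 0, 0), fun u p => ?_⟩
    simp only [magGrad_zero, map_mul, Complex.conj_I, Complex.ofReal_one, one_mul]
    ring
  | 1 =>
    refine ⟨fun p => Complex.I * cylDeriv (0, 0, 1) (fun p => g p / p.1) p -
        ω p.2.2 * (g p / p.1),
      ((hg.div_radius.cylDeriv _).const_mul _).memLp.sub (hg.div_radius.memLp_mul hω),
      _, hg.div_radius, (0, 0, 1), fun u p => ?_⟩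
    simp only [magGrad_one, map_sub, map_mul, map_div₀, Complex.conj_I, Complex.conj_ofReal,
      Complex.ofReal_zero, zero_mul, add_zero]
    ring
  | 2 =>
    refine ⟨fun p => Complex.I * cylDeriv (0, 1, 0) g p, ((hg.cylDeriv _).const_mul _).memLp,
      g, hg, (0, 1, 0), fun u p => ?_⟩
    simp only [magGrad_two, map_mul, Complex.conj_I, Complex.ofReal_zero, zero_mul, add_zero]
    ring

theorem exists_inner_magLp_eq (hω : MemLp ω 2 volume) (g : testSpace θ) (i : Fin 3) :
    ∃ T : L2 θ, ∀ u : testSpace θ,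
      inner ℂ (testToL2 θ g) (magLp θ hω u i) = inner ℂ T (testToL2 θ u) := by
  obtain ⟨T, hT, h⟩ := IsTest.exists_magGrad_adjoint g.2 hω i
  refine ⟨hT.toLp T, fun u => ?_⟩
  have hu : IsTest θ u := u.2
  refine (inner_toLp (IsTest.memLp g.2) (memLp_magGrad hω hu i)).trans
    (Eq.trans (sub_eq_zero.1 ?_) (inner_toLp hT hu.memLp).symm)
  rw [← integral_sub (integrable_conj_mul (IsTest.memLp g.2) (memLp_magGrad hω hu i))
    (integrable_conj_mul hT hu.memLp)]
  exact h u hu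

end MagneticGradient

section ClosedForm

variable {θ : ℝ} {ω : S1 → ℝ} {u v f : L2 θ} {X Y : Fld θ}

/-- The graph of the closure of the magnetic gradient: the closure, in `L²_cyl × (L²_cyl)³`, of the
graph of the magnetic gradient on test functions. -/
def gradGraph (θ : ℝ) (hω : MemLp ω 2 volume) : Submodule ℂ (L2 θ × Fld θ) :=
  (LinearMap.range ((testToL2 θ).prod (magLp θ hω))).topologicalClosure

theorem testToL2_magLp_mem_gradGraph (hω : MemLp ω 2 volume) (w : testSpace θ) :
    (testToL2 θ w, magLp θ hω w) ∈ gradGraph θ hω :=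
  Submodule.le_topologicalClosure _ ⟨w, rfl⟩

theorem isClosed_gradGraph (hω : MemLp ω 2 volume) :
    IsClosed (gradGraph θ hω : Set (L2 θ × Fld θ)) :=
  Submodule.isClosed_topologicalClosure _

theorem mem_gradGraph_iff_exists_tendsto (hω : MemLp ω 2 volume) :
    (u, X) ∈ gradGraph θ hω ↔ ∃ w : ℕ → testSpace θ,
      Tendsto (fun n => testToL2 θ (w n)) atTop (𝓝 u) ∧
        Tendsto (fun n => magLp θ hω (w n)) atTop (𝓝 X) := by
  constructor
  · intro h
    obtain ⟨x, hx, hlim⟩ := mem_closure_iff_seq_limit.1 h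
    choose w hw using hx
    obtain rfl : (fun n => (testToL2 θ (w n), magLp θ hω (w n))) = x := funext hw
    exact ⟨w, Prod.tendsto_iff _ _ |>.1 hlim⟩
  · rintro ⟨w, hu, hX⟩
    exact (isClosed_gradGraph hω).mem_of_tendsto (hu.prodMk_nhds hX)
      (.of_forall fun n => testToL2_magLp_mem_gradGraph hω (w n))

theorem eq_zero_of_zero_mem_gradGraph (hω : MemLp ω 2 volume)
    (h : ((0 : L2 θ), X) ∈ gradGraph θ hω) : X = 0 := by
  obtain ⟨w, hw, hwX⟩ := (mem_gradGraph_iff_exists_tendsto hω).1 h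
  ext1 i
  refine eq_zero_of_forall_inner_test_eq_zero fun g hg => ?_
  obtain ⟨T, hT⟩ := exists_inner_magLp_eq hω ⟨g, hg⟩ i
  have hlim : Tendsto (fun n => inner ℂ (testToL2 θ ⟨g, hg⟩) (magLp θ hω (w n) i)) atTop
      (𝓝 (inner ℂ (testToL2 θ ⟨g, hg⟩) (X i))) :=
    tendsto_const_nhds.inner (((PiLp.continuous_apply 2 _ i).tendsto X).comp hwX)
  simp only [hT] at hlim
  refine tendsto_nhds_unique hlim ?_
  simpa only [inner_zero_right] using (tendsto_const_nhds (x := T)).inner (𝕜 := ℂ) hw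

theorem eq_of_mem_gradGraph (hω : MemLp ω 2 volume) (hX : (u, X) ∈ gradGraph θ hω)
    (hY : (u, Y) ∈ gradGraph θ hω) : X = Y := by
  have h := (gradGraph θ hω).sub_mem hX hY
  rw [Prod.mk_sub_mk, sub_self] at h
  exact sub_eq_zero.1 (eq_zero_of_zero_mem_gradGraph hω h)

theorem tendsto_testToL2_iff {w : ℕ → testSpace θ} :
    Tendsto (fun n => testToL2 θ (w n)) atTop (𝓝 u) ↔
      Tendsto (fun n => eLpNorm (fun p => (w n : Cyl → ℂ) p - u p) 2 (cylMeasure θ)) atTop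
        (𝓝 0) := by
  rw [Lp.tendsto_Lp_iff_tendsto_eLpNorm']
  refine tendsto_congr fun n => eLpNorm_congr_ae ?_
  exact (IsTest.memLp (w n).2).coeFn_toLp.sub .rfl

theorem formConv_iff_tendsto_cauchySeq (hω : MemLp ω 2 volume) {w : ℕ → testSpace θ} :
    FormConv ω θ (fun n => w n) u ↔
      Tendsto (fun n => testToL2 θ (w n)) atTop (𝓝 u) ∧ CauchySeq fun n => magLp θ hω (w n) := by
  have hdist : ∀ m n, form0 ω θ (fun p => (w n : Cyl → ℂ) p - (w m : Cyl → ℂ) p) =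
      dist (magLp θ hω (w n)) (magLp θ hω (w m)) ^ 2 := fun m n => by
    rw [dist_eq_norm, ← map_sub, ← form0_eq_norm_sq]
    rfl
  rw [FormConv, tendsto_testToL2_iff, Metric.cauchySeq_iff]
  simp only [hdist]
  constructor
  · rintro ⟨-, hlim, hcau⟩
    refine ⟨hlim, fun ε hε => ?_⟩
    obtain ⟨N, hN⟩ := hcau (ε ^ 2) (by positivity)
    exact ⟨N, fun n hn m hm => lt_of_pow_lt_pow_left₀ 2 hε.le (hN n hn m hm)⟩
  · rintro ⟨hlim, hcau⟩
    refine ⟨fun n => (w n).2, hlim, fun ε hε => ?_⟩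
    obtain ⟨N, hN⟩ := hcau (Real.sqrt ε) (Real.sqrt_pos.2 hε)
    exact ⟨N, fun n hn m hm => (Real.lt_sqrt dist_nonneg).1 (hN n hn m hm)⟩

theorem FormConv.exists_tendsto_magLp {w : ℕ → Cyl → ℂ} (h : FormConv ω θ w u)
    (hω : MemLp ω 2 volume) :
    ∃ (w' : ℕ → testSpace θ) (X : Fld θ), (∀ n, (w' n : Cyl → ℂ) = w n) ∧
      Tendsto (fun n => magLp θ hω (w' n)) atTop (𝓝 X) ∧ (u, X) ∈ gradGraph θ hω := by
  let w' : ℕ → testSpace θ := fun n => ⟨w n, h.1 n⟩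
  obtain ⟨hlim, hcau⟩ := (formConv_iff_tendsto_cauchySeq hω (w := w')).1 h
  obtain ⟨X, hX⟩ := cauchySeq_tendsto_of_complete hcau
  exact ⟨w', X, fun _ => rfl, hX, (mem_gradGraph_iff_exists_tendsto hω).2 ⟨w', hlim, hX⟩⟩

theorem formClosable (hω : MemLp ω 2 volume) : FormClosable ω θ := by
  intro w hw
  obtain ⟨w', X, hw', hX, hmem⟩ := hw.exists_tendsto_magLp hω
  rw [eq_zero_of_zero_mem_gradGraph hω hmem] at hX
  simpa only [← hw', form0_eq_norm_sq hω, norm_zero, zero_pow two_ne_zero] using hX.norm.pow 2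

theorem mem_domQ_iff_exists_mem_gradGraph (hω : MemLp ω 2 volume) :
    u ∈ domQ ω θ ↔ ∃ X, (u, X) ∈ gradGraph θ hω := by
  constructor
  · rintro ⟨w, hw⟩
    obtain ⟨-, X, -, -, hX⟩ := hw.exists_tendsto_magLp hω
    exact ⟨X, hX⟩
  · rintro ⟨X, hX⟩
    obtain ⟨w, hlim, hX⟩ := (mem_gradGraph_iff_exists_tendsto hω).1 hX
    exact ⟨_, (formConv_iff_tendsto_cauchySeq hω).2 ⟨hlim, hX.cauchySeq⟩⟩

theorem sesqQ_eq_inner (hω : MemLp ω 2 volume) (hX : (u, X) ∈ gradGraph θ hω)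
    (hY : (v, Y) ∈ gradGraph θ hω) : sesqQ ω θ u v = inner ℂ X Y := by
  have hlim : ∀ w w' : ℕ → Cyl → ℂ, FormConv ω θ w u → FormConv ω θ w' v →
      Tendsto (fun n => sesq0 ω θ (w n) (w' n)) atTop (𝓝 (inner ℂ X Y)) := by
    intro w w' hw hw'
    obtain ⟨a, X', ha, haX, hmemX⟩ := hw.exists_tendsto_magLp hω
    obtain ⟨b, Y', hb, hbY, hmemY⟩ := hw'.exists_tendsto_magLp hω
    rw [eq_of_mem_gradGraph hω hX hmemX, eq_of_mem_gradGraph hω hY hmemY]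
    simpa only [← ha, ← hb, sesq0_eq_inner hω] using haX.inner hbY
  obtain ⟨w, hw⟩ := (mem_domQ_iff_exists_mem_gradGraph hω).2 ⟨X, hX⟩
  obtain ⟨w', hw'⟩ := (mem_domQ_iff_exists_mem_gradGraph hω).2 ⟨Y, hY⟩
  have hspec := Classical.epsilon_spec (p := fun c : ℂ => ∀ w w' : ℕ → Cyl → ℂ,
    FormConv ω θ w u → FormConv ω θ w' v →
      Tendsto (fun n => sesq0 ω θ (w n) (w' n)) atTop (𝓝 c)) ⟨_, hlim⟩
  exact tendsto_nhds_unique (hspec w w' hw hw') (hlim w w' hw hw')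

theorem mem_assocGraph_iff_inner_eq (hω : MemLp ω 2 volume) (hX : (u, X) ∈ gradGraph θ hω) :
    (u, f) ∈ assocGraph ω θ ↔ ∀ v Y, (v, Y) ∈ gradGraph θ hω → inner ℂ X Y = inner ℂ f v := by
  constructor
  · rintro ⟨-, h⟩ v Y hY
    exact (sesqQ_eq_inner hω hX hY).symm.trans
      (h v ((mem_domQ_iff_exists_mem_gradGraph hω).2 ⟨Y, hY⟩))
  · refine fun h => ⟨(mem_domQ_iff_exists_mem_gradGraph hω).2 ⟨X, hX⟩, fun v hv => ?_⟩
    obtain ⟨Y, hY⟩ := (mem_domQ_iff_exists_mem_gradGraph hω).1 hv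
    exact (sesqQ_eq_inner hω hX hY).trans (h v Y hY)

theorem exists_mem_gradGraph_of_mem_assocGraph (hω : MemLp ω 2 volume)
    (h : (u, f) ∈ assocGraph ω θ) : ∃ X, (u, X) ∈ gradGraph θ hω :=
  (mem_domQ_iff_exists_mem_gradGraph hω).1 h.1

/-- `assocGraph ω θ` as a linear subspace of `L²_cyl × L²_cyl`. -/
def assocSubmodule (θ : ℝ) (hω : MemLp ω 2 volume) : Submodule ℂ (L2 θ × L2 θ) where
  carrier := assocGraph ω θ
  add_mem' := by
    rintro ⟨u, f⟩ ⟨v, g⟩ hu hv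
    obtain ⟨X, hX⟩ := exists_mem_gradGraph_of_mem_assocGraph hω hu
    obtain ⟨Y, hY⟩ := exists_mem_gradGraph_of_mem_assocGraph hω hv
    rw [mem_assocGraph_iff_inner_eq hω hX] at hu
    rw [mem_assocGraph_iff_inner_eq hω hY] at hv
    refine (mem_assocGraph_iff_inner_eq hω ((gradGraph θ hω).add_mem hX hY)).2 fun x Z hZ => ?_
    rw [inner_add_left, inner_add_left, hu x Z hZ, hv x Z hZ]
  zero_mem' := (mem_assocGraph_iff_inner_eq hω (gradGraph θ hω).zero_mem).2 fun x Z _ => by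
    rw [inner_zero_left, inner_zero_left]
  smul_mem' := by
    rintro c ⟨u, f⟩ hu
    obtain ⟨X, hX⟩ := exists_mem_gradGraph_of_mem_assocGraph hω hu
    rw [mem_assocGraph_iff_inner_eq hω hX] at hu
    refine (mem_assocGraph_iff_inner_eq hω ((gradGraph θ hω).smul_mem c hX)).2 fun x Z hZ => ?_
    rw [inner_smul_left, inner_smul_left, hu x Z hZ]

theorem eq_zero_of_zero_mem_assocGraph (hω : MemLp ω 2 volume)
    (h : ((0 : L2 θ), f) ∈ assocGraph ω θ) : f = 0 := by
  refine eq_zero_of_forall_inner_test_eq_zero fun g hg => ?_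
  have hinner := (mem_assocGraph_iff_inner_eq hω (gradGraph θ hω).zero_mem).1 h _ _
    (testToL2_magLp_mem_gradGraph hω ⟨g, hg⟩)
  rw [inner_zero_left] at hinner
  exact inner_eq_zero_symm.1 hinner.symm

theorem coe_graph_opH (hω : MemLp ω 2 volume) :
    ((opH ω θ).graph : Set (L2 θ × L2 θ)) = assocGraph ω θ := by
  have hspan : Submodule.span ℂ (assocGraph ω θ) = assocSubmodule θ hω :=
    Submodule.span_eq (assocSubmodule θ hω)
  rw [opH, hspan, Submodule.toLinearPMap_graph_eq]
  · rfl
  · rintro ⟨u, f⟩ hmem (rfl : u = 0)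
    exact eq_zero_of_zero_mem_assocGraph hω hmem

end ClosedForm

section FormEquiv

variable {θ : ℝ} {ω₁ ω₂ ω₃ : S1 → ℝ} {U V : L2 θ ≃ₗᵢ[ℂ] L2 θ}

/-- The unitary map `U` transforms the closed form `Q_{ω₁,θ}` into `Q_{ω₂,θ}`, domains included. -/
structure FormEquiv (ω₁ ω₂ : S1 → ℝ) (θ : ℝ) (U : L2 θ ≃ₗᵢ[ℂ] L2 θ) : Prop where
  domQ_eq : domQ ω₂ θ = U '' domQ ω₁ θ
  sesqQ_eq : ∀ u ∈ domQ ω₁ θ, ∀ v ∈ domQ ω₁ θ, sesqQ ω₂ θ (U u) (U v) = sesqQ ω₁ θ u v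

theorem FormEquiv.apply_mem_domQ_iff (h : FormEquiv ω₁ ω₂ θ U) {u : L2 θ} :
    U u ∈ domQ ω₂ θ ↔ u ∈ domQ ω₁ θ := by
  rw [h.domQ_eq, U.injective.mem_set_image]

theorem FormEquiv.trans (h : FormEquiv ω₁ ω₂ θ U) (h' : FormEquiv ω₂ ω₃ θ V) :
    FormEquiv ω₁ ω₃ θ (U.trans V) where
  domQ_eq := by rw [h'.domQ_eq, h.domQ_eq, image_image]; rfl
  sesqQ_eq u hu v hv := (h'.sesqQ_eq _ (h.apply_mem_domQ_iff.2 hu) _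
    (h.apply_mem_domQ_iff.2 hv)).trans (h.sesqQ_eq u hu v hv)

theorem FormEquiv.formQ_eq (h : FormEquiv ω₁ ω₂ θ U) {u : L2 θ} (hu : u ∈ domQ ω₁ θ) :
    formQ ω₂ θ (U u) = formQ ω₁ θ u :=
  congrArg Complex.re (h.sesqQ_eq u hu u hu)

theorem FormEquiv.mem_assocGraph_iff (h : FormEquiv ω₁ ω₂ θ U) {u f : L2 θ} :
    (U u, U f) ∈ assocGraph ω₂ θ ↔ (u, f) ∈ assocGraph ω₁ θ := by
  refine and_congr_right_iff.2 (fun hu => ?_) |>.trans (and_congr_left' h.apply_mem_domQ_iff)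
  rw [h.domQ_eq, forall_mem_image]
  refine forall₂_congr fun v hv => ?_
  rw [h.sesqQ_eq u (h.apply_mem_domQ_iff.1 hu) v hv, U.inner_map_map]

theorem FormEquiv.mem_graph_opH_iff (h : FormEquiv ω₁ ω₂ θ U) (hω₁ : MemLp ω₁ 2 volume)
    (hω₂ : MemLp ω₂ 2 volume) {u f : L2 θ} :
    (U u, U f) ∈ (opH ω₂ θ).graph ↔ (u, f) ∈ (opH ω₁ θ).graph := by
  simp only [← SetLike.mem_coe, coe_graph_opH hω₁, coe_graph_opH hω₂, h.mem_assocGraph_iff]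

theorem FormEquiv.intertwines (h : FormEquiv ω₁ ω₂ θ U) (hω₁ : MemLp ω₁ 2 volume)
    (hω₂ : MemLp ω₂ 2 volume) : Intertwines U (opH ω₁ θ) (opH ω₂ θ) := by
  constructor
  · ext u
    obtain ⟨u, rfl⟩ := U.surjective u
    rw [U.injective.mem_set_image, SetLike.mem_coe, SetLike.mem_coe, LinearPMap.mem_domain_iff,
      LinearPMap.mem_domain_iff, U.surjective.exists]
    exact exists_congr fun f => h.mem_graph_opH_iff hω₁ hω₂
  · intro x y hxy
    have hmem := (h.mem_graph_opH_iff hω₁ hω₂).2 ((opH ω₁ θ).mem_graph x)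
    rw [← hxy] at hmem
    exact ((LinearPMap.image_iff y.2).2 hmem).symm

theorem map_mem_gradGraph {hω₁ : MemLp ω₁ 2 volume} {hω₂ : MemLp ω₂ 2 volume}
    {S : L2 θ → L2 θ} {T : Fld θ → Fld θ} (hS : Continuous S) (hT : Continuous T)
    (h : ∀ w : testSpace θ, (S (testToL2 θ w), T (magLp θ hω₁ w)) ∈ gradGraph θ hω₂)
    {u : L2 θ} {X : Fld θ} (hX : (u, X) ∈ gradGraph θ hω₁) : (S u, T X) ∈ gradGraph θ hω₂ := by
  obtain ⟨w, hu, hX⟩ := (mem_gradGraph_iff_exists_tendsto hω₁).1 hX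
  exact (isClosed_gradGraph hω₂).mem_of_tendsto
    (((hS.tendsto u).comp hu).prodMk_nhds ((hT.tendsto X).comp hX)) (.of_forall fun n => h (w n))

theorem FormEquiv.of_gradGraph {hω₁ : MemLp ω₁ 2 volume} {hω₂ : MemLp ω₂ 2 volume}
    (W : Fld θ ≃ₗᵢ[ℂ] Fld θ)
    (hW : ∀ w : testSpace θ, (U (testToL2 θ w), W (magLp θ hω₁ w)) ∈ gradGraph θ hω₂)
    (hW_symm : ∀ w : testSpace θ,
      (U.symm (testToL2 θ w), W.symm (magLp θ hω₂ w)) ∈ gradGraph θ hω₁) :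
    FormEquiv ω₁ ω₂ θ U := by
  have hmap : ∀ {u X}, (u, X) ∈ gradGraph θ hω₁ → (U u, W X) ∈ gradGraph θ hω₂ :=
    map_mem_gradGraph U.continuous W.continuous hW
  have hdom : ∀ u, U u ∈ domQ ω₂ θ ↔ u ∈ domQ ω₁ θ := fun u => by
    rw [mem_domQ_iff_exists_mem_gradGraph hω₁, mem_domQ_iff_exists_mem_gradGraph hω₂]
    refine ⟨fun ⟨X, hX⟩ => ⟨W.symm X, ?_⟩, fun ⟨X, hX⟩ => ⟨W X, hmap hX⟩⟩
    simpa using map_mem_gradGraph U.symm.continuous W.symm.continuous hW_symm hX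
  refine ⟨?_, fun u hu v hv => ?_⟩
  · ext u
    obtain ⟨u, rfl⟩ := U.surjective u
    rw [U.injective.mem_set_image, hdom]
  · obtain ⟨X, hX⟩ := (mem_domQ_iff_exists_mem_gradGraph hω₁).1 hu
    obtain ⟨Y, hY⟩ := (mem_domQ_iff_exists_mem_gradGraph hω₁).1 hv
    rw [sesqQ_eq_inner hω₁ hX hY, sesqQ_eq_inner hω₂ (hmap hX) (hmap hY), W.inner_map_map]

end FormEquiv

section Primitive

variable {δ η : S1 → ℝ}

theorem periodic_comp_coe (δ : S1 → ℝ) :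
    Function.Periodic (fun ξ : ℝ => δ ξ) (2 * Real.pi) := fun ξ => by
  simp only [AddCircle.coe_add_period]

theorem intervalIntegrable_of_integrable (hδ : Integrable δ volume) (a b : ℝ) :
    IntervalIntegrable (fun ξ : ℝ => δ ξ) volume a b := by
  refine (periodic_comp_coe δ).intervalIntegrable Real.two_pi_pos.ne' (t := 0) ?_ a b
  rw [intervalIntegrable_iff_integrableOn_Ioc_of_le (by linarith [Real.two_pi_pos])]
  exact (AddCircle.measurePreserving_mk (2 * Real.pi) 0).integrable_comp_of_integrable hδ

theorem integrable_of_continuous (hη : Continuous η) : Integrable η volume :=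
  hη.integrable_of_hasCompactSupport (HasCompactSupport.of_compactSpace η)

theorem intervalIntegral_zero_two_pi (δ : S1 → ℝ) :
    ∫ ξ in (0 : ℝ)..(2 * Real.pi), δ ξ = ∫ x, δ x := by
  simpa only [zero_add] using AddCircle.intervalIntegral_preimage (2 * Real.pi) 0 δ

/-- The primitive, on the universal cover `ℝ`, of a function on the circle. -/
def primitive (δ : S1 → ℝ) (t : ℝ) : ℝ := ∫ ξ in (0 : ℝ)..t, δ ξ

theorem primitive_add_two_pi (hδ : Integrable δ volume) (t : ℝ) :
    primitive δ (t + 2 * Real.pi) = primitive δ t + ∫ x, δ x := by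
  rw [primitive, primitive, ← intervalIntegral.integral_add_adjacent_intervals
    (intervalIntegrable_of_integrable hδ 0 t) (intervalIntegrable_of_integrable hδ t _),
    (periodic_comp_coe δ).intervalIntegral_add_eq t 0, zero_add, intervalIntegral_zero_two_pi]

theorem continuous_primitive (hδ : Integrable δ volume) : Continuous (primitive δ) :=
  intervalIntegral.continuous_primitive (intervalIntegrable_of_integrable hδ) 0

theorem primitive_sub (hδ : Integrable δ volume) (hη : Integrable η volume) (t : ℝ) :
    primitive (δ - η) t = primitive δ t - primitive η t :=
  intervalIntegral.integral_sub (intervalIntegrable_of_integrable hδ 0 t)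
    (intervalIntegrable_of_integrable hη 0 t)

theorem abs_primitive_le (hδ : Integrable δ volume) {t : ℝ} (ht : t ∈ Icc 0 (2 * Real.pi)) :
    |primitive δ t| ≤ ∫ x, |δ x| := by
  rw [← intervalIntegral_zero_two_pi]
  exact (intervalIntegral.abs_integral_le_integral_abs ht.1).trans
    (intervalIntegral.integral_mono_interval le_rfl ht.1 ht.2 (ae_of_all _ fun _ => abs_nonneg _)
      (intervalIntegrable_of_integrable hδ.abs 0 _))

theorem hasDerivAt_primitive (hη : Continuous η) (t : ℝ) : HasDerivAt (primitive η) (η t) t :=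
  (hη.comp (AddCircle.continuous_mk' _)).integral_hasStrictDerivAt 0 t |>.hasDerivAt

theorem contDiff_primitive (hη : Continuous η) (hs : ContDiff ℝ (⊤ : ℕ∞) fun t : ℝ => η t) :
    ContDiff ℝ (⊤ : ℕ∞) (primitive η) := by
  rw [contDiff_infty_iff_deriv]
  refine ⟨fun t => (hasDerivAt_primitive hη t).differentiableAt, ?_⟩
  rwa [show deriv (primitive η) = fun t : ℝ => η t from
    funext fun t => (hasDerivAt_primitive hη t).deriv]

/-- The function `e^{i ∫_0^φ δ}` on the circle, the angle `φ` being taken in `[0, 2π)`. -/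
def phase (δ : S1 → ℝ) (x : S1) : ℂ :=
  Complex.exp (Complex.I * primitive δ (AddCircle.equivIco (2 * Real.pi) 0 x))

theorem norm_phase (δ : S1 → ℝ) (x : S1) : ‖phase δ x‖ = 1 :=
  Complex.norm_exp_I_mul_ofReal _

theorem phase_neg (δ : S1 → ℝ) (x : S1) : phase (-δ) x = (phase δ x)⁻¹ := by
  simp only [phase, primitive, Pi.neg_apply, intervalIntegral.integral_neg, Complex.ofReal_neg,
    mul_neg, Complex.exp_neg]

theorem measurable_phase (hδ : Integrable δ volume) : Measurable (phase δ) := by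
  have hcoe : Measurable fun x : S1 => (AddCircle.equivIco (2 * Real.pi) 0 x : ℝ) :=
    measurable_subtype_coe.comp (AddCircle.measurableEquivIco (2 * Real.pi) 0).measurable
  have hprim := (continuous_primitive hδ).measurable.comp hcoe
  unfold phase
  fun_prop

theorem norm_phase_sub_le (hη : Integrable η volume) (hδ : Integrable δ volume) (x : S1) :
    ‖phase η x - phase δ x‖ ≤ ∫ x, |η x - δ x| := by
  set t := AddCircle.equivIco (2 * Real.pi) 0 x
  have hfactor : phase η x - phase δ x =
      phase δ x * (Complex.exp (Complex.I * primitive (η - δ) t) - 1) := by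
    rw [primitive_sub hη hδ, Complex.ofReal_sub, mul_sub Complex.I, Complex.exp_sub, mul_sub,
      mul_one, phase, phase, mul_div_cancel₀ _ (Complex.exp_ne_zero _)]
  rw [hfactor, norm_mul, norm_phase, one_mul]
  exact Real.norm_exp_I_mul_ofReal_sub_one_le.trans
    (abs_primitive_le (hη.sub hδ) ⟨t.2.1, by linarith [t.2.2]⟩)

theorem phase_coe (hδ : Integrable δ volume) {k : ℤ} (hk : ∫ x, δ x = k * (2 * Real.pi)) (t : ℝ) :
    phase δ t = Complex.exp (Complex.I * primitive δ t) := by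
  have hper : Function.Periodic (fun t : ℝ => Complex.exp (Complex.I * primitive δ t))
      (2 * Real.pi) := fun t => by
    have harg : Complex.I * (primitive δ (t + 2 * Real.pi) : ℂ) =
        Complex.I * primitive δ t + k * (2 * Real.pi * Complex.I) := by
      rw [primitive_add_two_pi hδ, hk]
      push_cast
      ring
    exact (congrArg Complex.exp harg).trans (Complex.exp_periodic.int_mul k _)
  calc phase δ t
      = hper.lift ((AddCircle.equivIco (2 * Real.pi) 0 (t : S1) : ℝ) : S1) :=
        (hper.lift_coe _).symm
    _ = Complex.exp (Complex.I * primitive δ t) := by rw [AddCircle.coe_equivIco, hper.lift_coe]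

theorem smoothCyl_phase (hη : Continuous η) (hs : ContDiff ℝ (⊤ : ℕ∞) fun t : ℝ => η t) {k : ℤ}
    (hk : ∫ x, η x = k * (2 * Real.pi)) : SmoothCyl fun p => phase η p.2.2 := by
  have hcover : (fun p : Cyl => phase η p.2.2) ∘ cover =
      fun q => Complex.exp (Complex.I * primitive η q.2.2) :=
    funext fun q => phase_coe (integrable_of_continuous hη) hk q.2.2
  rw [SmoothCyl, hcover]
  exact (contDiff_const.mul (Complex.ofRealCLM.contDiff.comp
    ((contDiff_primitive hη hs).comp (contDiff_snd.comp contDiff_snd)))).cexp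

theorem cylDeriv_phase (hη : Continuous η) {k : ℤ} (hk : ∫ x, η x = k * (2 * Real.pi))
    (v : ℝ × ℝ × ℝ) (p : Cyl) :
    cylDeriv v (fun p => phase η p.2.2) p = v.2.2 * (Complex.I * η p.2.2) * phase η p.2.2 := by
  obtain ⟨⟨r, z, t⟩, rfl⟩ := cover_surjective p
  have hphase := phase_coe (integrable_of_continuous hη) hk
  have hline : HasDerivAt (fun s : ℝ => t + s * v.2.2) v.2.2 0 := by
    simpa using ((hasDerivAt_id (0 : ℝ)).mul_const v.2.2).const_add t
  have hfun : (fun s : ℝ => phase η (cover (r, z, t) + cover (s • v)).2.2) =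
      fun s => Complex.exp (Complex.I * primitive η (t + s * v.2.2)) :=
    funext fun s => by rw [← map_add]; exact hphase _
  have hderiv := ((((hasDerivAt_primitive hη _).comp (0 : ℝ) hline).ofReal_comp).const_mul
    Complex.I).cexp
  rw [cylDeriv, hfun]
  refine hderiv.deriv.trans ?_
  simp only [Function.comp_apply, zero_mul, add_zero, cover_apply, hphase, Complex.ofReal_mul]
  ring

end Primitive

section Approximation

variable {δ : S1 → ℝ}

theorem tendsto_integral_norm_of_tendsto_eLpNorm {α E : Type*} [MeasurableSpace α]
    [NormedAddCommGroup E] {μ : Measure α} [IsFiniteMeasure μ] {p : ENNReal} (hp : 1 ≤ p)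
    {f : ℕ → α → E} (hf : ∀ n, AEStronglyMeasurable (f n) μ)
    (h : Tendsto (fun n => eLpNorm (f n) p μ) atTop (𝓝 0)) :
    Tendsto (fun n => ∫ x, ‖f n x‖ ∂μ) atTop (𝓝 0) := by
  have hexp : 0 ≤ 1 / (1 : ENNReal).toReal - 1 / p.toReal := by
    rcases eq_or_ne p ⊤ with rfl | hp_top
    · simp
    · have hp_real : 1 ≤ p.toReal := by simpa using ENNReal.toReal_mono hp_top hp
      simpa using inv_le_one_of_one_le₀ hp_real
  have hbound : Tendsto (fun n => eLpNorm (f n) p μ * μ univ ^ (1 / (1 : ENNReal).toReal -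
      1 / p.toReal)) atTop (𝓝 0) := by
    simpa only [zero_mul] using ENNReal.Tendsto.mul_const h
      (.inr (ENNReal.rpow_ne_top_of_nonneg hexp (measure_ne_top μ univ)))
  have hone : Tendsto (fun n => eLpNorm (f n) 1 μ) atTop (𝓝 0) :=
    tendsto_of_tendsto_of_tendsto_of_le_of_le tendsto_const_nhds hbound (fun _ => zero_le)
      fun n => eLpNorm_le_eLpNorm_mul_rpow_measure_univ hp (hf n)
  refine ((ENNReal.tendsto_toReal ENNReal.zero_ne_top).comp hone).congr fun n => ?_
  rw [Function.comp_apply, eLpNorm_one_eq_lintegral_enorm]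
  exact (integral_norm_eq_lintegral_enorm (hf n)).symm

theorem tendsto_eLpNorm_average_of_tendsto_eLpNorm {α E : Type*} [MeasurableSpace α]
    [NormedAddCommGroup E] [NormedSpace ℝ E] {μ : Measure α} [IsFiniteMeasure μ] {p : ENNReal}
    (hp : 1 ≤ p) (hp_top : p ≠ ⊤) {f : ℕ → α → E} (hf : ∀ n, AEStronglyMeasurable (f n) μ)
    (h : Tendsto (fun n => eLpNorm (f n) p μ) atTop (𝓝 0)) :
    Tendsto (fun n => eLpNorm (fun _ : α => ⨍ x, f n x ∂μ) p μ) atTop (𝓝 0) := by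
  have hint : Tendsto (fun n => ∫ x, f n x ∂μ) atTop (𝓝 0) :=
    squeeze_zero_norm (fun n => norm_integral_le_integral_norm (f n))
      (tendsto_integral_norm_of_tendsto_eLpNorm hp hf h)
  have haverage : Tendsto (fun n => ‖⨍ x, f n x ∂μ‖ₑ) atTop (𝓝 0) := by
    simpa only [average_eq, smul_zero, enorm_zero] using (hint.const_smul (μ.real univ)⁻¹).enorm
  have hfin : μ univ ^ (1 / p.toReal) ≠ ⊤ :=
    ENNReal.rpow_ne_top_of_nonneg (by positivity) (measure_ne_top μ univ)
  simpa only [eLpNorm_const' _ (one_pos.trans_le hp).ne' hp_top, zero_mul] using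
    ENNReal.Tendsto.mul_const haverage (.inr hfin)

theorem contDiff_of_mem_span_fourier {q : C(S1, ℂ)}
    (hq : q ∈ Submodule.span ℂ (range (fourier (T := 2 * Real.pi)))) :
    ContDiff ℝ (⊤ : ℕ∞) fun t : ℝ => q t := by
  induction hq using Submodule.span_induction with
  | mem _ h =>
    obtain ⟨n, rfl⟩ := h
    simp only [fourier_coe_apply]
    exact ((contDiff_const.mul Complex.ofRealCLM.contDiff).div_const _).cexp
  | zero => exact contDiff_const
  | add _ _ _ _ hp hq => exact hp.add hq
  | smul c _ _ hq => exact hq.const_smul c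

theorem exists_smooth_tendsto_eLpNorm (hδ : MemLp δ 2 volume) :
    ∃ η : ℕ → S1 → ℝ, (∀ n, Continuous (η n)) ∧ (∀ n, ContDiff ℝ (⊤ : ℕ∞) fun t : ℝ => η n t) ∧
      Tendsto (fun n => eLpNorm (η n - δ) 2 volume) atTop (𝓝 0) := by
  have hδ' : MemLp (fun x => (δ x : ℂ)) 2 volume := hδ.ofReal
  have hdense := (ContinuousMap.toLp_denseRange ℂ (volume : Measure S1) ℂ
    (p := 2) (by norm_num)).topologicalClosure_map_submodule
      (span_fourier_closure_eq_top (T := 2 * Real.pi))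
  have hmem : hδ'.toLp ∈ closure (ContinuousMap.toLp 2 volume ℂ ''
      (Submodule.span ℂ (range (fourier (T := 2 * Real.pi))) : Set C(S1, ℂ))) :=
    (SetLike.ext_iff.1 hdense _).2 Submodule.mem_top
  obtain ⟨P, hP, hlim⟩ := mem_closure_iff_seq_limit.1 hmem
  choose q hq hqP using hP
  refine ⟨fun n x => (q n x).re, fun n => Complex.continuous_re.comp (q n).continuous,
    fun n => Complex.reCLM.contDiff.comp (contDiff_of_mem_span_fourier (hq n)), ?_⟩
  rw [Lp.tendsto_Lp_iff_tendsto_eLpNorm'] at hlim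
  refine tendsto_of_tendsto_of_tendsto_of_le_of_le tendsto_const_nhds hlim (fun _ => zero_le)
    fun n => eLpNorm_mono_ae ?_
  filter_upwards [hδ'.coeFn_toLp, ContinuousMap.coeFn_toLp volume (q n) (𝕜 := ℂ) (p := 2)]
    with x hδx hqx
  rw [Pi.sub_apply, Pi.sub_apply, ← hqP, hqx, hδx]
  exact Complex.abs_re_le_norm (q n x - δ x)

theorem exists_smooth_integral_eq_tendsto_eLpNorm (hδ : MemLp δ 2 volume) :
    ∃ η : ℕ → S1 → ℝ, (∀ n, Continuous (η n)) ∧ (∀ n, ContDiff ℝ (⊤ : ℕ∞) fun t : ℝ => η n t) ∧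
      (∀ n, ∫ x, η n x = ∫ x, δ x) ∧
      Tendsto (fun n => eLpNorm (η n - δ) 2 volume) atTop (𝓝 0) := by
  obtain ⟨η, hη, hs, hlim⟩ := exists_smooth_tendsto_eLpNorm hδ
  let c : ℕ → ℝ := fun n => ⨍ x, (η n - δ) x
  have hηm : ∀ n, MemLp (η n - δ) 2 volume := fun n =>
    ((hη n).memLp_of_hasCompactSupport (HasCompactSupport.of_compactSpace _)).sub hδ
  have hc := tendsto_eLpNorm_average_of_tendsto_eLpNorm one_le_two ENNReal.ofNat_ne_top
    (fun n => (hηm n).1) hlim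
  have hcont (n) : Continuous fun x => η n x - c n := (hη n).sub continuous_const
  refine ⟨fun n x => η n x - c n, hcont,
    fun n => (hs n).sub contDiff_const, fun n => ?_, ?_⟩
  · rw [← sub_eq_zero,
      ← integral_sub (integrable_of_continuous (hcont n)) (hδ.integrable one_le_two),
      ← integral_sub_average volume (η n - δ)]
    exact integral_congr_ae (ae_of_all _ fun x => sub_right_comm (η n x) (c n) (δ x))
  · refine tendsto_of_tendsto_of_tendsto_of_le_of_le tendsto_const_nhds
      (by simpa only [add_zero] using hlim.add hc) (fun _ => zero_le) fun n => ?_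
    have hsplit : (fun x => η n x - c n) - δ = (η n - δ) - fun _ => c n :=
      funext fun x => sub_right_comm _ _ _
    dsimp only
    rw [hsplit]
    exact eLpNorm_sub_le (hηm n).1 aestronglyMeasurable_const one_le_two

end Approximation

section Phase

variable {θ : ℝ} {ω ω₁ ω₂ δ η : S1 → ℝ} {u : Cyl → ℂ} {k : ℤ}

theorem magGrad_phase_mul (hη : Continuous η) (hs : ContDiff ℝ (⊤ : ℕ∞) fun t : ℝ => η t)
    (hk : ∫ x, η x = k * (2 * Real.pi)) (hu : SmoothCyl u) (p : Cyl) (i : Fin 3) :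
    magGrad ω (fun p => phase η p.2.2 * u p) p i = phase η p.2.2 * magGrad (ω + η) u p i := by
  have hderiv (v) := cylDeriv_mul (v := v) (p := p) (smoothCyl_phase hη hs hk) hu
  match i with
  | 0 =>
    simp only [magGrad_zero, hderiv, cylDeriv_phase hη hk, Complex.ofReal_zero]
    ring
  | 1 =>
    simp only [magGrad_one, hderiv, cylDeriv_phase hη hk, Complex.ofReal_one, Pi.add_apply,
      Complex.ofReal_add]
    linear_combination (η p.2.2 * phase η p.2.2 * (u p / p.1)) * Complex.I_sq
  | 2 =>
    simp only [magGrad_two, hderiv, cylDeriv_phase hη hk, Complex.ofReal_zero]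
    ring

theorem tendsto_fld_iff {X : ℕ → Fld θ} {Y : Fld θ} :
    Tendsto X atTop (𝓝 Y) ↔ ∀ i, Tendsto (fun n => X n i) atTop (𝓝 (Y i)) :=
  (PiLp.homeomorph 2 fun _ : Fin 3 => L2 θ).isInducing.tendsto_nhds_iff.trans tendsto_pi_nhds

theorem norm_magGrad_sub_le (ω₁ ω₂ : S1 → ℝ) (u : Cyl → ℂ) (p : Cyl) (i : Fin 3) :
    ‖magGrad ω₁ u p i - magGrad ω₂ u p i‖ ≤ ‖((ω₁ - ω₂) p.2.2 : ℂ) * (u p / p.1)‖ := by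
  match i with
  | 0 => simp only [magGrad_zero, sub_self, norm_zero, norm_nonneg]
  | 1 =>
    rw [magGrad_one, magGrad_one, sub_sub_sub_cancel_left, norm_sub_rev, ← sub_mul,
      Pi.sub_apply, Complex.ofReal_sub]
  | 2 => simp only [magGrad_two, sub_self, norm_zero, norm_nonneg]

theorem tendsto_magLp {ωs : ℕ → S1 → ℝ} (hωs : ∀ n, MemLp (ωs n) 2 volume)
    (hω : MemLp ω 2 volume) (hlim : Tendsto (fun n => eLpNorm (ωs n - ω) 2 volume) atTop (𝓝 0))
    (u : testSpace θ) : Tendsto (fun n => magLp θ (hωs n) u) atTop (𝓝 (magLp θ hω u)) := by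
  obtain ⟨C, hC⟩ := IsTest.exists_eLpNorm_mul_le (IsTest.div_radius u.2)
  have hbound : Tendsto (fun n => C * eLpNorm (ωs n - ω) 2 volume) atTop (𝓝 0) := by
    simpa only [mul_zero] using ENNReal.Tendsto.const_mul hlim (.inr ENNReal.coe_ne_top)
  refine tendsto_fld_iff.2 fun i => (Lp.tendsto_Lp_iff_tendsto_eLpNorm'' _
    (fun n => memLp_magGrad (hωs n) u.2 i) _ (memLp_magGrad hω u.2 i)).2 ?_
  exact tendsto_of_tendsto_of_tendsto_of_le_of_le tendsto_const_nhds hbound (fun _ => zero_le)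
    fun n => (eLpNorm_mono fun p => norm_magGrad_sub_le (ωs n) ω u p i).trans
      (hC _ ((hωs n).sub hω).1)

/-- Multiplication by `e^{i ∫_0^φ δ}`, as a unitary operator on `L²_cyl`. -/
def phaseUnitary (θ : ℝ) (hδ : Integrable δ volume) : L2 θ ≃ₗᵢ[ℂ] L2 θ :=
  mulUnitary θ (fun p => phase δ p.2.2)
    ((measurable_phase hδ).comp (measurable_snd.comp measurable_snd)) fun p => norm_phase δ p.2.2

theorem coeFn_phaseUnitary (hδ : Integrable δ volume) (f : L2 θ) :
    phaseUnitary θ hδ f =ᵐ[cylMeasure θ] fun p => phase δ p.2.2 * f p :=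
  coeFn_mulFun _ ((measurable_phase hδ).comp (measurable_snd.comp measurable_snd))
    (fun p => norm_phase δ p.2.2) f

theorem phaseUnitary_toLp (hδ : Integrable δ volume) {f : Cyl → ℂ} (hf : MemLp f 2 (cylMeasure θ))
    (hf' : MemLp (fun p => phase δ p.2.2 * f p) 2 (cylMeasure θ)) :
    phaseUnitary θ hδ (hf.toLp f) = hf'.toLp _ := by
  apply Lp.ext
  filter_upwards [coeFn_phaseUnitary hδ (hf.toLp f), hf.coeFn_toLp, hf'.coeFn_toLp] with p h hp hp'
  rw [h, hp, hp']

theorem norm_phaseUnitary_sub_le (hη : Integrable η volume) (hδ : Integrable δ volume) (f : L2 θ) :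
    ‖phaseUnitary θ hη f - phaseUnitary θ hδ f‖ ≤ (∫ x, |η x - δ x|) * ‖f‖ := by
  refine Lp.norm_le_mul_norm_of_ae_le_mul ?_
  filter_upwards [coeFn_phaseUnitary hη f, coeFn_phaseUnitary hδ f,
    Lp.coeFn_sub (phaseUnitary θ hη f) (phaseUnitary θ hδ f)] with p hηp hδp hsub
  rw [hsub, Pi.sub_apply, hηp, hδp, ← sub_mul, norm_mul]
  exact mul_le_mul_of_nonneg_right (norm_phase_sub_le hη hδ _) (norm_nonneg _)

theorem tendsto_phaseUnitary {ηs : ℕ → S1 → ℝ} (hηs : ∀ n, Integrable (ηs n) volume)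
    (hδ : Integrable δ volume) (hlim : Tendsto (fun n => ∫ x, |ηs n x - δ x|) atTop (𝓝 0))
    {f : ℕ → L2 θ} {g : L2 θ} (hf : Tendsto f atTop (𝓝 g)) :
    Tendsto (fun n => phaseUnitary θ (hηs n) (f n)) atTop (𝓝 (phaseUnitary θ hδ g)) := by
  rw [tendsto_iff_norm_sub_tendsto_zero] at hf ⊢
  refine squeeze_zero (fun _ => norm_nonneg _) (fun n => ?_)
    (by simpa only [zero_mul, add_zero] using hf.add (hlim.mul_const ‖g‖))
  calc ‖phaseUnitary θ (hηs n) (f n) - phaseUnitary θ hδ g‖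
      = ‖phaseUnitary θ (hηs n) (f n - g) +
          (phaseUnitary θ (hηs n) g - phaseUnitary θ hδ g)‖ := by
        rw [map_sub, sub_add_sub_cancel]
    _ ≤ ‖f n - g‖ + (∫ x, |ηs n x - δ x|) * ‖g‖ :=
        (norm_add_le _ _).trans (add_le_add ((phaseUnitary θ (hηs n)).norm_map _).le
          (norm_phaseUnitary_sub_le (hηs n) hδ g))

theorem phaseUnitary_symm (hδ : Integrable δ volume) :
    (phaseUnitary θ hδ).symm = phaseUnitary θ hδ.neg := by
  ext1 f
  rw [LinearIsometryEquiv.symm_apply_eq]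
  apply Lp.ext
  filter_upwards [coeFn_phaseUnitary hδ.neg f,
    coeFn_phaseUnitary hδ (phaseUnitary θ hδ.neg f)] with p hneg h
  have hne : phase δ p.2.2 ≠ 0 := norm_ne_zero_iff.1 (by rw [norm_phase]; exact one_ne_zero)
  rw [h, hneg, phase_neg, mul_inv_cancel_left₀ hne]

/-- Multiplication of vector fields by `e^{i ∫_0^φ δ}`. -/
def phaseFld (θ : ℝ) (hδ : Integrable δ volume) : Fld θ ≃ₗᵢ[ℂ] Fld θ :=
  LinearIsometryEquiv.piLpCongrRight 2 fun _ => phaseUnitary θ hδ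

theorem phaseFld_apply (hδ : Integrable δ volume) (X : Fld θ) (i : Fin 3) :
    phaseFld θ hδ X i = phaseUnitary θ hδ (X i) := rfl

theorem phaseFld_symm (hδ : Integrable δ volume) :
    (phaseFld θ hδ).symm = phaseFld θ hδ.neg := by
  ext1 X
  ext1 i
  exact congrArg (fun U : L2 θ ≃ₗᵢ[ℂ] L2 θ => U (X i)) (phaseUnitary_symm hδ)

theorem phase_mem_gradGraph_of_smooth (hη : Continuous η)
    (hs : ContDiff ℝ (⊤ : ℕ∞) fun t : ℝ => η t) (hk : ∫ x, η x = k * (2 * Real.pi))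
    (hω : MemLp ω 2 volume) (hωη : MemLp (ω + η) 2 volume) (u : testSpace θ) :
    (phaseUnitary θ (integrable_of_continuous hη) (testToL2 θ u),
      phaseFld θ (integrable_of_continuous hη) (magLp θ hωη u)) ∈ gradGraph θ hω := by
  let w : testSpace θ := ⟨fun p => phase η p.2.2 * u.1 p,
    IsTest.smooth_mul u.2 (smoothCyl_phase hη hs hk)⟩
  have hw : phaseUnitary θ (integrable_of_continuous hη) (testToL2 θ u) = testToL2 θ w :=
    phaseUnitary_toLp _ (IsTest.memLp u.2) (IsTest.memLp w.2)
  have hgrad : phaseFld θ (integrable_of_continuous hη) (magLp θ hωη u) = magLp θ hω w := by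
    ext1 i
    have hmag := funext fun p => magGrad_phase_mul (ω := ω) hη hs hk (IsTest.smooth u.2) p i
    have hmem := memLp_magGrad hω w.2 i
    rw [phaseFld_apply, magLp_apply, magLp_apply]
    simp only [w, hmag] at hmem ⊢
    exact phaseUnitary_toLp _ _ hmem
  rw [hw, hgrad]
  exact testToL2_magLp_mem_gradGraph hω w

theorem phase_mem_gradGraph (hω₁ : MemLp ω₁ 2 volume) (hω₂ : MemLp ω₂ 2 volume)
    (hδ : MemLp δ 2 volume) (hadd : ω₂ + δ = ω₁) (hk : ∫ x, δ x = k * (2 * Real.pi))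
    (u : testSpace θ) :
    (phaseUnitary θ (hδ.integrable one_le_two) (testToL2 θ u),
      phaseFld θ (hδ.integrable one_le_two) (magLp θ hω₁ u)) ∈ gradGraph θ hω₂ := by
  obtain ⟨η, hη, hs, hmean, hlim⟩ := exists_smooth_integral_eq_tendsto_eLpNorm hδ
  have hηm (n) : MemLp (η n) 2 volume :=
    (hη n).memLp_of_hasCompactSupport (HasCompactSupport.of_compactSpace _)
  have hlim_phase : Tendsto (fun n => ∫ x, |η n x - δ x|) atTop (𝓝 0) :=
    tendsto_integral_norm_of_tendsto_eLpNorm one_le_two (fun n => ((hηm n).sub hδ).1) hlim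
  have hlim_add : Tendsto (fun n => eLpNorm (ω₂ + η n - ω₁) 2 volume) atTop (𝓝 0) := by
    simpa only [← hadd, add_sub_add_left_eq_sub] using hlim
  have hlim_magLp := tendsto_magLp (fun n => hω₂.add (hηm n)) hω₁ hlim_add u
  have hlim_mul {f : ℕ → L2 θ} {g : L2 θ} (hf : Tendsto f atTop (𝓝 g)) :=
    tendsto_phaseUnitary (fun n => integrable_of_continuous (hη n)) (hδ.integrable one_le_two)
      hlim_phase hf
  exact (isClosed_gradGraph hω₂).mem_of_tendsto
    ((hlim_mul tendsto_const_nhds).prodMk_nhds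
      (tendsto_fld_iff.2 fun i => hlim_mul (tendsto_fld_iff.1 hlim_magLp i)))
    (.of_forall fun n => phase_mem_gradGraph_of_smooth (hη n) (hs n) ((hmean n).trans hk) hω₂
      (hω₂.add (hηm n)) u)

theorem formEquiv_phaseUnitary (hω : MemLp ω 2 volume) (hδ : MemLp δ 2 volume)
    (hk : ∫ x, δ x = k * (2 * Real.pi)) :
    FormEquiv (ω + δ) ω θ (phaseUnitary θ (hδ.integrable one_le_two)) := by
  have hk_neg : ∫ x, (-δ) x = (-k : ℤ) * (2 * Real.pi) := by
    simp only [Pi.neg_apply, integral_neg, hk, Int.cast_neg, neg_mul]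
  refine FormEquiv.of_gradGraph (phaseFld θ (hδ.integrable one_le_two))
    (phase_mem_gradGraph (hω.add hδ) hω hδ rfl hk) fun w => ?_
  rw [phaseUnitary_symm, phaseFld_symm]
  exact phase_mem_gradGraph hω (hω.add hδ) hδ.neg (add_neg_cancel_right ω δ) hk_neg w

end Phase

section Gauge

variable {θ : ℝ} {ω : S1 → ℝ}

theorem memLp_constFlux (ω : S1 → ℝ) (k : ℤ) : MemLp (constFlux ω k) 2 volume := memLp_const _

theorem memLp_constFlux_sub (hω : MemLp ω 2 volume) (k : ℤ) :
    MemLp (constFlux ω k - ω) 2 volume :=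
  (memLp_constFlux ω k).sub hω

theorem integral_constFlux_sub (hω : Integrable ω volume) (k : ℤ) :
    ∫ x, (constFlux ω k - ω) x = k * (2 * Real.pi) := by
  have hflux : flux ω = (2 * Real.pi)⁻¹ * ∫ x, ω x := by rw [flux, intervalIntegral_zero_two_pi]
  have hconst : ∫ x, constFlux ω k x = 2 * Real.pi * (flux ω + k) := by
    rw [← intervalIntegral_zero_two_pi]
    simp only [constFlux, intervalIntegral.integral_const, sub_zero, smul_eq_mul]
  simp only [Pi.sub_apply]
  rw [integral_sub ((memLp_constFlux ω k).integrable one_le_two) hω, hconst, hflux]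
  field_simp
  ring

theorem gaugeFactor_eq_phase (hω : Integrable ω volume) (k : ℤ) :
    gaugeFactor ω k = phase (constFlux ω k - ω) := by
  funext x
  rw [phase, primitive_sub ((memLp_constFlux ω k).integrable one_le_two) hω]
  simp only [gaugeFactor, gaugeV, primitive, constFlux, intervalIntegral.integral_const, sub_zero,
    smul_eq_mul, mul_comm]

theorem formEquiv_gaugeTransform (θ : ℝ) (hω : MemLp ω 2 volume) (k : ℤ) :
    FormEquiv (constFlux ω k) ω θ (gaugeTransform θ hω k) := by
  have hω_int : Integrable ω volume := hω.integrable one_le_two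
  have hgauge : gaugeTransform θ hω k =
      phaseUnitary θ ((memLp_constFlux_sub hω k).integrable one_le_two) := by
    simp only [gaugeTransform, phaseUnitary, gaugeFactor_eq_phase hω_int]
  have h := formEquiv_phaseUnitary (θ := θ) hω (memLp_constFlux_sub hω k)
    (integral_constFlux_sub hω_int k)
  rwa [add_sub_cancel, ← hgauge] at h

end Gauge

section Reflection

/-- The reflection `φ ↦ -φ` of the angle, which reverses the sign of the magnetic flux. -/
def reflect : Cyl ≃ₜ Cyl :=
  (Homeomorph.refl ℝ).prodCongr ((Homeomorph.refl ℝ).prodCongr (Homeomorph.neg S1))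

theorem reflect_apply (p : Cyl) : reflect p = (p.1, p.2.1, -p.2.2) := rfl

theorem reflect_reflect (p : Cyl) : reflect (reflect p) = p := by
  simp only [reflect_apply, neg_neg]

variable {θ : ℝ} {ω : S1 → ℝ} {u : Cyl → ℂ}

theorem measurePreserving_reflect : MeasurePreserving reflect (cylMeasure θ) (cylMeasure θ) := by
  have hvolume : MeasurePreserving reflect volume volume :=
    (MeasurePreserving.id volume).prod
      ((MeasurePreserving.id volume).prod (Measure.measurePreserving_neg (volume : Measure S1)))
  have hdensity : MeasurePreserving reflect
      ((volume : Measure Cyl).withDensity fun p => ENNReal.ofReal p.1)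
      ((volume : Measure Cyl).withDensity fun p => ENNReal.ofReal p.1) := by
    refine ⟨hvolume.measurable, Measure.ext fun s hs => ?_⟩
    rw [Measure.map_apply hvolume.measurable hs, withDensity_apply _ (hvolume.measurable hs),
      withDensity_apply _ hs]
    exact hvolume.setLIntegral_comp_preimage hs
      (f := fun p : Cyl => ENNReal.ofReal p.1) (by fun_prop)
  exact hdensity.restrict_preimage measurableSet_Lay

theorem IsTest.comp_reflect (hu : IsTest θ u) : IsTest θ (u ∘ reflect) := by
  refine ⟨?_, hu.hasCompactSupport.comp_homeomorph reflect, fun p hp => ?_⟩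
  · have hsmooth : ContDiff ℝ (⊤ : ℕ∞)
        fun q : ℝ × ℝ × ℝ => ((q.1, q.2.1, -q.2.2) : ℝ × ℝ × ℝ) := by fun_prop
    exact ContDiff.comp (g := u ∘ cover) hu.smooth hsmooth
  · have hp' : reflect p ∈ tsupport u := tsupport_comp_subset_preimage u reflect.continuous hp
    have hLay : reflect p ∈ Lay θ := hu.2.2 hp'
    exact hLay

theorem cylDeriv_comp_reflect (v : ℝ × ℝ × ℝ) (u : Cyl → ℂ) (p : Cyl) :
    cylDeriv v (u ∘ reflect) p = cylDeriv (v.1, v.2.1, -v.2.2) u (reflect p) := by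
  obtain ⟨a, b, c⟩ := v
  have hline (s : ℝ) : reflect (p + cover (s • (a, b, c))) =
      reflect p + cover (s • (a, b, -c)) := by
    simp [reflect_apply, cover_apply, add_comm]
  simp only [cylDeriv, Function.comp_apply, hline]

theorem magGrad_comp_reflect (ω : S1 → ℝ) (u : Cyl → ℂ) (p : Cyl) (i : Fin 3) :
    magGrad (fun x => -ω (-x)) (u ∘ reflect) p i =
      (if i = 1 then -1 else 1) * magGrad ω u (reflect p) i := by
  match i with
  | 0 => simp [magGrad_zero, cylDeriv_comp_reflect]
  | 1 =>
    have hneg : ((0, 0, -1) : ℝ × ℝ × ℝ) = -(0, 0, 1) := by simp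
    rw [magGrad_one, magGrad_one, cylDeriv_comp_reflect, hneg, cylDeriv_neg, if_pos rfl,
      Complex.ofReal_neg]
    simp only [Function.comp_apply, reflect_apply]
    ring
  | 2 => simp [magGrad_two, cylDeriv_comp_reflect]

theorem compMeasurePreserving_reflect_involutive : Function.Involutive
    (Lp.compMeasurePreservingₗ ℂ (E := ℂ) (p := 2) reflect
      (measurePreserving_reflect (θ := θ))) := by
  refine fun u => Lp.ext ?_
  filter_upwards [Lp.coeFn_compMeasurePreserving (Lp.compMeasurePreserving reflect
      measurePreserving_reflect u) (measurePreserving_reflect (θ := θ)),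
    measurePreserving_reflect.quasiMeasurePreserving.ae
      (Lp.coeFn_compMeasurePreserving u (measurePreserving_reflect (θ := θ)))] with p houter hinner
  exact houter.trans (hinner.trans (congrArg u (reflect_reflect p)))

/-- Composition with the reflection, as a unitary operator on `L²_cyl`. -/
def reflectUnitary (θ : ℝ) : L2 θ ≃ₗᵢ[ℂ] L2 θ where
  toLinearEquiv := LinearEquiv.ofInvolutive
    (Lp.compMeasurePreservingₗ ℂ reflect measurePreserving_reflect)
    compMeasurePreserving_reflect_involutive
  norm_map' u := Lp.norm_compMeasurePreserving u measurePreserving_reflect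

theorem reflectUnitary_symm : (reflectUnitary θ).symm = reflectUnitary θ := rfl

theorem reflectUnitary_toLp {f : Cyl → ℂ} (hf : MemLp f 2 (cylMeasure θ)) :
    reflectUnitary θ (hf.toLp f) =
      (hf.comp_measurePreserving measurePreserving_reflect).toLp (f ∘ reflect) :=
  Lp.toLp_compMeasurePreserving hf measurePreserving_reflect

/-- The action of the reflection on vector fields, which reverses their angular component. -/
def reflectFld (θ : ℝ) : Fld θ ≃ₗᵢ[ℂ] Fld θ :=
  LinearIsometryEquiv.piLpCongrRight 2 fun i =>
    if i = 1 then (reflectUnitary θ).trans (LinearIsometryEquiv.neg ℂ) else reflectUnitary θ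

theorem reflectFld_apply (X : Fld θ) (i : Fin 3) :
    reflectFld θ X i = (if i = 1 then -1 else 1 : ℂ) • reflectUnitary θ (X i) := by
  fin_cases i
  exacts [(one_smul ℂ _).symm, (neg_one_smul ℂ _).symm, (one_smul ℂ _).symm]

theorem reflectFld_symm : (reflectFld θ).symm = reflectFld θ := by
  ext1 X
  ext1 i
  fin_cases i
  exacts [rfl, (reflectUnitary θ).symm.map_neg (X 1), rfl]

theorem reflect_mem_gradGraph (hω : MemLp ω 2 volume)
    (hω' : MemLp (fun x => -ω (-x)) 2 volume) (u : testSpace θ) :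
    (reflectUnitary θ (testToL2 θ u), reflectFld θ (magLp θ hω u)) ∈ gradGraph θ hω' := by
  let w : testSpace θ := ⟨u.1 ∘ reflect, IsTest.comp_reflect u.2⟩
  have hw : reflectUnitary θ (testToL2 θ u) = testToL2 θ w := reflectUnitary_toLp (IsTest.memLp u.2)
  have hgrad : reflectFld θ (magLp θ hω u) = magLp θ hω' w := by
    ext1 i
    rw [reflectFld_apply, magLp_apply, magLp_apply, reflectUnitary_toLp, ← MemLp.toLp_const_smul]
    exact MemLp.toLp_congr _ _ (.of_forall fun p => (magGrad_comp_reflect ω u.1 p i).symm)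
  rw [hw, hgrad]
  exact testToL2_magLp_mem_gradGraph hω' w

theorem formEquiv_reflectUnitary (θ : ℝ) (hω : MemLp ω 2 volume) :
    FormEquiv ω (fun x => -ω (-x)) θ (reflectUnitary θ) := by
  have hω' : MemLp (fun x => -ω (-x)) 2 volume :=
    (hω.comp_measurePreserving (Measure.measurePreserving_neg volume)).neg
  refine FormEquiv.of_gradGraph (reflectFld θ) (reflect_mem_gradGraph hω hω') fun w => ?_
  have hω_eq : ω = fun x => - -ω (- -x) := by simp only [neg_neg]
  rw [reflectUnitary_symm, reflectFld_symm]
  simpa only [neg_neg] using reflect_mem_gradGraph hω' (hω_eq ▸ hω) w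

end Reflection

end ConicalLayer

end

theorem propositionA1 (θ : ℝ) (hθ : θ ∈ Set.Ioo 0 (Real.pi / 2))
    (ω : S1 → ℝ) (hω : MeasureTheory.MemLp ω 2 MeasureTheory.volume) (k : ℤ) :
    -- the objects are well defined: `Q_{ω,θ,0}` is closable, and `H_{ω,θ}` has the defining graph
    (FormClosable ω θ ∧ ((opH ω θ).graph : Set (L2 θ × L2 θ)) = assocGraph ω θ) ∧
    -- (i)
    domQ ω θ = gaugeTransform θ hω k '' domQ (constFlux ω k) θ ∧
    -- (ii)
    (∀ u ∈ domQ (constFlux ω k) θ,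
      formQ ω θ (gaugeTransform θ hω k u) = formQ (constFlux ω k) θ u) ∧
    -- unitary equivalence of the operators, through the gauge transform
    Intertwines (gaugeTransform θ hω k) (opH (constFlux ω k) θ) (opH ω θ) ∧
    -- reduction to a constant flux in `[0, 1/2]`
    ∃ c ∈ Set.Icc (0 : ℝ) (1 / 2), (∃ m : ℤ, c = |flux ω + m|) ∧
      UnitarilyEquivalent (opH (fun _ => c) θ) (opH ω θ) := by
  have gauge (j : ℤ) := formEquiv_gaugeTransform θ hω j
  have gauge_intertwines (j : ℤ) := (gauge j).intertwines (memLp_constFlux ω j) hω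
  refine ⟨⟨formClosable hω, coe_graph_opH hω⟩, (gauge k).domQ_eq, fun u => (gauge k).formQ_eq,
    gauge_intertwines k, ?_⟩
  obtain ⟨m, hm⟩ : ∃ m : ℤ, |flux ω + m| ≤ 1 / 2 :=
    ⟨-round (flux ω), by simpa only [Int.cast_neg, sub_eq_add_neg] using abs_sub_round (flux ω)⟩
  refine ⟨|flux ω + m|, ⟨abs_nonneg _, hm⟩, ⟨m, rfl⟩, ?_⟩
  rcases le_total 0 (flux ω + m) with hsign | hsign
  · rw [abs_of_nonneg hsign]
    exact ⟨_, gauge_intertwines m⟩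
  · have reflection := formEquiv_reflectUnitary θ (ω := fun _ => |flux ω + m|) (memLp_const _)
    simp only [abs_of_nonpos hsign, neg_neg] at reflection ⊢
    exact ⟨_, (reflection.trans (gauge m)).intertwines (memLp_const _) hω⟩
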